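/- **Setting.** Let $d\in\{2,3\}$, let $\Omega\subset\mathbb R^d$ be a bounded domain with Lipschitz boundary, and let $0<T<\infty$. Write $(\cdot,\cdot)$ for $L^2(\Omega)$ inner products, $\langle\cdot,\cdot\rangle$ for duality pairings, $\varepsilon(u)=\frac12(\nabla u+\nabla u^\top)$, $H_0(\nabla\cdot,\Omega)$ for the fields in $L^2(\Omega)^d$ with divergence in $L^2(\Omega)$ and vanishing normal trace, and $H^{-1}(\Omega)=(H^1_0(\Omega)^d)'$. Let $\gamma,\ell>0$ and assume: - $\Psi:\mathbb R\to\mathbb R$ is differentiable and $\Psi'$ is Lipschitz continuous; - the mobility $m$, permeability $\kappa$, compressibility coefficient $M$ and Biot–Willis coefficient $\alpha$ are positive constants; - the stiffness tensor $\mathbb C$ is constant, has the symmetries of linear elasticity, and satisfies $c_{\mathbb C}|A|^2\le A:\mathbb C A\le C_{\mathbb C}|A|^2$ for all symmetric $A\in\mathbb R^{d\times d}$, with constants $c_{\mathbb C},C_{\mathbb C}>0$; - the eigenstrain is $\mathcal T(\varphi)=\hat\varepsilon\,\varphi+\varepsilon^\ast$ with constant symmetric tensors $\hat\varepsilon,\varepsilon^\ast$.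 Data are $R,S_f\in L^2(\Omega)$ and $f\in H^{-1}(\Omega)$ (independent of time), $\varphi_0\in H^1(\Omega)$ with $\Psi(\varphi_0)\in L^1(\Omega)$, and $\theta_0\in L^2(\Omega)$. A *weak solution* of the Cahn–Hilliard–Biot system (without secondary consolidation) for these data is a quintuple $(\varphi,\mu,u,\theta,q)$ with $$\varphi\in L^\infty([0,T];H^1(\Omega))\cap H^1([0,T];H^1(\Omega)'),\quad \mu\in L^2([0,T];H^1(\Omega)),\quad u\in L^\infty([0,T];H^1_0(\Omega)^d),$$ $$\theta\in L^\infty([0,T];L^2(\Omega))\cap H^1([0,T];H^1(\Omega)'),\quad q\in L^2([0,T];L^2(\Omega)^d),$$ $\varphi(0)=\varphi_0$ and $\theta(0)=\theta_0$ in $H^1(\Omega)'$ (for the representatives that are continuous in time), such that $$\int_0^T\langle\partial_t\varphi,\eta\rangle+(m\nabla\mu,\nabla\eta)\,dt=\int_0^T(R,\eta)\,dt,$$ $$\int_0^T(\mu,\eta)-\tfrac{\gamma}{\ell}(\Psi'(\varphi),\eta)-\gamma\ell(\nabla\varphi,\nabla\eta)+\big(\hat\varepsilon:\mathbb C(\varepsilon(u)-\mathcal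 T(\varphi)),\eta\big)\,dt=0,$$ $$\int_0^T\big(\mathbb C(\varepsilon(u)-\mathcal T(\varphi)),\varepsilon(v)\big)-\big(M\alpha(\theta-\alpha\nabla\cdot u),\nabla\cdot v\big)\,dt=\int_0^T\langle f,v\rangle\,dt,$$ $$\int_0^T\langle\partial_t\theta,\eta\rangle-(q,\nabla\eta)\,dt=\int_0^T(S_f,\eta)\,dt,$$ $$\int_0^T(\kappa^{-1}q,w)-\big(M(\theta-\alpha\nabla\cdot u),\nabla\cdot w\big)\,dt=0$$ for all $\eta\in L^2([0,T];H^1(\Omega))$, $v\in L^2([0,T];H^1_0(\Omega)^d)$ and $w\in L^2([0,T];H_0(\nabla\cdot,\Omega))$. **Lemma.** There is a constant $C>0$, depending only on $\Omega$, $T$ and the material laws and parameters ($\gamma,\ell,\Psi,m,\kappa,M,\alpha,\mathbb C,\mathcal T$), such that for any two sets of data $(R_i,f_i,S_{f_i},\varphi_{0,i},\theta_{0,i})$, $i=1,2$, and any corresponding weak solutions $(\varphi_i,\mu_i,u_i,\theta_i,q_i)$ with the additional regularity $q_i\in L^2([0,T];H_0(\nabla\cdot,\Omega))$, $$\operatorname*{ess\,sup}_{t\in[0,T]}\|\varphi_1(t)-\varphi_2(t)\|_{L^2(\Omega)}^2+\int_0^T\|\mu_1-\mu_2\|_{L^2(\Omega)}^2\,dt$$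 $$\le C\Big[\|\varphi_{0,1}-\varphi_{0,2}\|_{L^2(\Omega)}^2+\int_0^T\Big(\|u_1-u_2\|_{H^1(\Omega)}^2+\|R_1-R_2\|_{L^2(\Omega)}^2\Big)dt\Big].$$ -/

import Mathlib

open MeasureTheory Set
open scoped NNReal ENNReal ContDiff

noncomputable section

namespace CHB

/-! ### Function spaces on a set `Ω ⊆ ℝᵈ` -/

/-- Euclidean space `ℝᵈ`. -/
abbrev E (d : ℕ) : Type := EuclideanSpace ℝ (Fin d)

/-- Around each boundary point, `Ω` is the strict epigraph, in some unit direction `e`, of a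
Lipschitz function `g` of the coordinates orthogonal to `e`. -/
def HasLipschitzBoundary {d : ℕ} (Ω : Set (E d)) : Prop :=
  ∀ x ∈ frontier Ω, ∃ (e : E d) (g : E d → ℝ) (K : ℝ≥0) (r : ℝ),
    ‖e‖ = 1 ∧ 0 < r ∧ LipschitzWith K g ∧ (∀ (y : E d) (s : ℝ), g (y + s • e) = g y) ∧
      ∀ y ∈ Metric.ball x r, (y ∈ Ω ↔ g y < inner ℝ e y)

/-- `L²(Ω)`. -/
abbrev L2 {d : ℕ} (Ω : Set (E d)) : Type := Lp ℝ 2 (volume.restrict Ω)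

/-- `L²(Ω)ᵈ`. -/
abbrev L2v {d : ℕ} (Ω : Set (E d)) : Type := Lp (E d) 2 (volume.restrict Ω)

/-- `ψ ∈ C_c^∞(Ω)`. -/
structure IsTest {d : ℕ} (Ω : Set (E d)) (ψ : E d → ℝ) : Prop where
  smooth : ContDiff ℝ ∞ ψ
  compact : HasCompactSupport ψ
  supp : tsupport ψ ⊆ Ω

/-- The classical partial derivative `∂ᵢψ`. -/
def pderiv {d : ℕ} (i : Fin d) (ψ : E d → ℝ) (x : E d) : ℝ :=
  fderiv ℝ ψ x (EuclideanSpace.single i 1)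

lemma IsTest.memLp {d : ℕ} {Ω : Set (E d)} {ψ : E d → ℝ} (h : IsTest Ω ψ) :
    MemLp ψ 2 (volume.restrict Ω) :=
  h.smooth.continuous.memLp_of_hasCompactSupport h.compact

lemma IsTest.memLp_pderiv {d : ℕ} {Ω : Set (E d)} {ψ : E d → ℝ} (h : IsTest Ω ψ) (i : Fin d) :
    MemLp (pderiv i ψ) 2 (volume.restrict Ω) := by
  have hc : Continuous (pderiv i ψ) :=
    (h.smooth.continuous_fderiv (by simp)).clm_apply continuous_const
  exact hc.memLp_of_hasCompactSupport (h.compact.fderiv_apply ℝ (EuclideanSpace.single i 1))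

lemma memLp_comp {d : ℕ} {Ω : Set (E d)} (g : L2v Ω) (i : Fin d) :
    MemLp (fun x => g x i) 2 (volume.restrict Ω) :=
  (EuclideanSpace.proj (𝕜 := ℝ) i).comp_memLp' (Lp.memLp g)

/-- `g` is the weak gradient of `v` in `Ω`. -/
def IsWeakGrad {d : ℕ} (Ω : Set (E d)) (v : L2 Ω) (g : L2v Ω) : Prop :=
  ∀ ψ, IsTest Ω ψ → ∀ i, ∫ x in Ω, v x * pderiv i ψ x = -∫ x in Ω, g x i * ψ x

/-- `r` is the weak divergence of `q` in `Ω`. -/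
def IsWeakDiv {d : ℕ} (Ω : Set (E d)) (q : L2v Ω) (r : L2 Ω) : Prop :=
  ∀ ψ, IsTest Ω ψ → ∫ x in Ω, ∑ i, q x i * pderiv i ψ x = -∫ x in Ω, r x * ψ x

/-- The pairs `(v, ∇v)` in `L²(Ω) × L²(Ω)ᵈ`. -/
def H1Submodule {d : ℕ} (Ω : Set (E d)) : Submodule ℝ (WithLp 2 (L2 Ω × L2v Ω)) where
  carrier := {w | IsWeakGrad Ω w.fst w.snd}
  zero_mem' := by
    intro ψ _ i
    have h1 : ∫ x in Ω, (0 : L2 Ω) x * pderiv i ψ x = 0 := by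
      rw [integral_congr_ae (g := fun _ => 0)]
      · simp
      · filter_upwards [Lp.coeFn_zero ℝ 2 (volume.restrict Ω)] with x hx
        rw [hx]; simp
    have h2 : ∫ x in Ω, (0 : L2v Ω) x i * ψ x = 0 := by
      rw [integral_congr_ae (g := fun _ => 0)]
      · simp
      · filter_upwards [Lp.coeFn_zero (E d) 2 (volume.restrict Ω)] with x hx
        rw [hx]; simp
    change ∫ x in Ω, (0 : L2 Ω) x * pderiv i ψ x = -∫ x in Ω, (0 : L2v Ω) x i * ψ x
    rw [h1, h2, neg_zero]
  add_mem' := by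
    intro a b ha hb ψ hψ i
    have h1 : ∫ x in Ω, (a.fst + b.fst : L2 Ω) x * pderiv i ψ x
        = (∫ x in Ω, a.fst x * pderiv i ψ x) + ∫ x in Ω, b.fst x * pderiv i ψ x := by
      refine (integral_congr_ae ?_).trans (integral_add ((Lp.memLp a.fst).integrable_mul (hψ.memLp_pderiv i))
        ((Lp.memLp b.fst).integrable_mul (hψ.memLp_pderiv i)))
      filter_upwards [Lp.coeFn_add a.fst b.fst] with x hx
      rw [hx]; simp [add_mul]
    have h2 : ∫ x in Ω, (a.snd + b.snd : L2v Ω) x i * ψ x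
        = (∫ x in Ω, a.snd x i * ψ x) + ∫ x in Ω, b.snd x i * ψ x := by
      refine (integral_congr_ae ?_).trans (integral_add ((memLp_comp a.snd i).integrable_mul hψ.memLp)
        ((memLp_comp b.snd i).integrable_mul hψ.memLp))
      filter_upwards [Lp.coeFn_add a.snd b.snd] with x hx
      rw [hx]; simp [add_mul]
    have e1 := ha ψ hψ i
    have e2 := hb ψ hψ i
    change ∫ x in Ω, (a.fst + b.fst : L2 Ω) x * pderiv i ψ x
      = -∫ x in Ω, (a.snd + b.snd : L2v Ω) x i * ψ x
    rw [h1, h2, e1, e2]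
    ring
  smul_mem' := by
    intro c a ha ψ hψ i
    have h1 : ∫ x in Ω, (c • a.fst : L2 Ω) x * pderiv i ψ x
        = c * ∫ x in Ω, a.fst x * pderiv i ψ x := by
      rw [← integral_const_mul]
      apply integral_congr_ae
      filter_upwards [Lp.coeFn_smul c a.fst] with x hx
      rw [hx]; simp [mul_assoc]
    have h2 : ∫ x in Ω, (c • a.snd : L2v Ω) x i * ψ x = c * ∫ x in Ω, a.snd x i * ψ x := by
      rw [← integral_const_mul]
      apply integral_congr_ae
      filter_upwards [Lp.coeFn_smul c a.snd] with x hx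
      rw [hx]; simp [mul_assoc]
    have e1 := ha ψ hψ i
    change ∫ x in Ω, (c • a.fst : L2 Ω) x * pderiv i ψ x
      = -∫ x in Ω, (c • a.snd : L2v Ω) x i * ψ x
    rw [h1, h2, e1]
    ring

/-- `H¹(Ω)`, as the space of pairs `(v, ∇v)`, with the norm `(‖v‖² + ‖∇v‖²)^{1/2}`. -/
def H1 {d : ℕ} (Ω : Set (E d)) : Type := H1Submodule Ω

instance {d : ℕ} (Ω : Set (E d)) : NormedAddCommGroup (H1 Ω) :=
  inferInstanceAs (NormedAddCommGroup (H1Submodule Ω))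

instance {d : ℕ} (Ω : Set (E d)) : InnerProductSpace ℝ (H1 Ω) :=
  inferInstanceAs (InnerProductSpace ℝ (H1Submodule Ω))

/-- The function underlying an element of `H¹(Ω)`. -/
def fn {d : ℕ} {Ω : Set (E d)} (w : H1 Ω) : L2 Ω :=
  WithLp.fst (Subtype.val w : WithLp 2 (L2 Ω × L2v Ω))

/-- The weak gradient of an element of `H¹(Ω)`. -/
def grad {d : ℕ} {Ω : Set (E d)} (w : H1 Ω) : L2v Ω :=
  WithLp.snd (Subtype.val w : WithLp 2 (L2 Ω × L2v Ω))

/-- `H¹₀(Ω)`, the closure of `C_c^∞(Ω)` in `H¹(Ω)`. -/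
def H10 {d : ℕ} (Ω : Set (E d)) : Submodule ℝ (H1 Ω) :=
  (Submodule.span ℝ
    {w : H1 Ω | ∃ ψ, IsTest Ω ψ ∧ fn w =ᵐ[volume.restrict Ω] ψ}).topologicalClosure

/-- `H¹₀(Ω)ᵈ`, with the norm `(∑ᵢ ‖uᵢ‖²_{H¹(Ω)})^{1/2}`. -/
def H10v {d : ℕ} (Ω : Set (E d)) : Type := PiLp 2 (fun _ : Fin d => H10 Ω)

instance {d : ℕ} (Ω : Set (E d)) : NormedAddCommGroup (H10v Ω) :=
  inferInstanceAs (NormedAddCommGroup (PiLp 2 (fun _ : Fin d => H10 Ω)))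

instance {d : ℕ} (Ω : Set (E d)) : InnerProductSpace ℝ (H10v Ω) :=
  inferInstanceAs (InnerProductSpace ℝ (PiLp 2 (fun _ : Fin d => H10 Ω)))

/-- The component `uᵢ`, as an element of `H¹(Ω)`. -/
def comp {d : ℕ} {Ω : Set (E d)} (u : H10v Ω) (i : Fin d) : H1 Ω :=
  ((WithLp.ofLp u : Fin d → H10 Ω) i : H1 Ω)

/-- The pairs `(q, ∇·q)` in `L²(Ω)ᵈ × L²(Ω)`. -/
def HDivSubmodule {d : ℕ} (Ω : Set (E d)) : Submodule ℝ (WithLp 2 (L2v Ω × L2 Ω)) where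
  carrier := {w | IsWeakDiv Ω w.fst w.snd}
  zero_mem' := by
    intro ψ _
    have h1 : ∫ x in Ω, ∑ i, (0 : L2v Ω) x i * pderiv i ψ x = 0 := by
      rw [integral_congr_ae (g := fun _ => 0)]
      · simp
      · filter_upwards [Lp.coeFn_zero (E d) 2 (volume.restrict Ω)] with x hx
        rw [hx]; simp
    have h2 : ∫ x in Ω, (0 : L2 Ω) x * ψ x = 0 := by
      rw [integral_congr_ae (g := fun _ => 0)]
      · simp
      · filter_upwards [Lp.coeFn_zero ℝ 2 (volume.restrict Ω)] with x hx
        rw [hx]; simp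
    change ∫ x in Ω, ∑ i, (0 : L2v Ω) x i * pderiv i ψ x = -∫ x in Ω, (0 : L2 Ω) x * ψ x
    rw [h1, h2, neg_zero]
  add_mem' := by
    intro a b ha hb ψ hψ
    have h1 : ∫ x in Ω, ∑ i, (a.fst + b.fst : L2v Ω) x i * pderiv i ψ x
        = (∫ x in Ω, ∑ i, a.fst x i * pderiv i ψ x) + ∫ x in Ω, ∑ i, b.fst x i * pderiv i ψ x := by
      refine (integral_congr_ae ?_).trans (integral_add (integrable_finsetSum _ fun i _ =>
          (memLp_comp a.fst i).integrable_mul (hψ.memLp_pderiv i))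
        (integrable_finsetSum _ fun i _ =>
          (memLp_comp b.fst i).integrable_mul (hψ.memLp_pderiv i)))
      filter_upwards [Lp.coeFn_add a.fst b.fst] with x hx
      rw [hx]; simp [add_mul, Finset.sum_add_distrib]
    have h2 : ∫ x in Ω, (a.snd + b.snd : L2 Ω) x * ψ x
        = (∫ x in Ω, a.snd x * ψ x) + ∫ x in Ω, b.snd x * ψ x := by
      refine (integral_congr_ae ?_).trans (integral_add ((Lp.memLp a.snd).integrable_mul hψ.memLp)
        ((Lp.memLp b.snd).integrable_mul hψ.memLp))
      filter_upwards [Lp.coeFn_add a.snd b.snd] with x hx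
      rw [hx]; simp [add_mul]
    have e1 := ha ψ hψ
    have e2 := hb ψ hψ
    change ∫ x in Ω, ∑ i, (a.fst + b.fst : L2v Ω) x i * pderiv i ψ x
      = -∫ x in Ω, (a.snd + b.snd : L2 Ω) x * ψ x
    rw [h1, h2, e1, e2]
    ring
  smul_mem' := by
    intro c a ha ψ hψ
    have h1 : ∫ x in Ω, ∑ i, (c • a.fst : L2v Ω) x i * pderiv i ψ x
        = c * ∫ x in Ω, ∑ i, a.fst x i * pderiv i ψ x := by
      rw [← integral_const_mul]
      apply integral_congr_ae
      filter_upwards [Lp.coeFn_smul c a.fst] with x hx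
      rw [hx]; simp [mul_assoc, Finset.mul_sum]
    have h2 : ∫ x in Ω, (c • a.snd : L2 Ω) x * ψ x = c * ∫ x in Ω, a.snd x * ψ x := by
      rw [← integral_const_mul]
      apply integral_congr_ae
      filter_upwards [Lp.coeFn_smul c a.snd] with x hx
      rw [hx]; simp [mul_assoc]
    have e1 := ha ψ hψ
    change ∫ x in Ω, ∑ i, (c • a.fst : L2v Ω) x i * pderiv i ψ x
      = -∫ x in Ω, (c • a.snd : L2 Ω) x * ψ x
    rw [h1, h2, e1]
    ring

/-- `H(∇·, Ω)`, as the space of pairs `(q, ∇·q)`, with the norm `(‖q‖² + ‖∇·q‖²)^{1/2}`. -/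
def HDiv {d : ℕ} (Ω : Set (E d)) : Type := HDivSubmodule Ω

instance {d : ℕ} (Ω : Set (E d)) : NormedAddCommGroup (HDiv Ω) :=
  inferInstanceAs (NormedAddCommGroup (HDivSubmodule Ω))

instance {d : ℕ} (Ω : Set (E d)) : InnerProductSpace ℝ (HDiv Ω) :=
  inferInstanceAs (InnerProductSpace ℝ (HDivSubmodule Ω))

/-- The vector field underlying an element of `H(∇·, Ω)`. -/
def fluxFn {d : ℕ} {Ω : Set (E d)} (w : HDiv Ω) : L2v Ω :=
  WithLp.fst (Subtype.val w : WithLp 2 (L2v Ω × L2 Ω))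

/-- The weak divergence of an element of `H(∇·, Ω)`. -/
def fluxDiv {d : ℕ} {Ω : Set (E d)} (w : HDiv Ω) : L2 Ω :=
  WithLp.snd (Subtype.val w : WithLp 2 (L2v Ω × L2 Ω))

/-- `H₀(∇·, Ω)`: the fields in `H(∇·, Ω)` with vanishing normal trace, that is, with
`(q, ∇v) + (∇·q, v) = 0` for all `v ∈ H¹(Ω)`. -/
def HDiv0 {d : ℕ} (Ω : Set (E d)) : Submodule ℝ (HDiv Ω) where
  carrier := {q | ∀ v : H1 Ω, inner ℝ (fluxFn q) (grad v) + inner ℝ (fluxDiv q) (fn v) = 0}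
  zero_mem' := by
    intro v
    change inner ℝ (0 : L2v Ω) (grad v) + inner ℝ (0 : L2 Ω) (fn v) = 0
    rw [inner_zero_left, inner_zero_left, add_zero]
  add_mem' := by
    intro a b ha hb v
    have h1 := ha v
    have h2 := hb v
    change inner ℝ (fluxFn a + fluxFn b) (grad v) + inner ℝ (fluxDiv a + fluxDiv b) (fn v) = 0
    rw [inner_add_left, inner_add_left]
    linarith
  smul_mem' := by
    intro c a ha v
    have h1 := ha v
    change inner ℝ (c • fluxFn a) (grad v) + inner ℝ (c • fluxDiv a) (fn v) = 0
    rw [real_inner_smul_left, real_inner_smul_left, ← mul_add, h1, mul_zero]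

/-- The dual space `H¹(Ω)'`. -/
abbrev H1Dual {d : ℕ} (Ω : Set (E d)) : Type := StrongDual ℝ (H1 Ω)

/-- The dual space `H⁻¹(Ω)` of `H¹₀(Ω)ᵈ`. -/
abbrev HNeg1v {d : ℕ} (Ω : Set (E d)) : Type := StrongDual ℝ (H10v Ω)

/-- The map `w ↦ w` from `H¹(Ω)` to `L²(Ω)`. -/
def fnL {d : ℕ} (Ω : Set (E d)) : H1 Ω →L[ℝ] L2 Ω :=
  (WithLp.fstL 2 ℝ (L2 Ω) (L2v Ω)).comp (H1Submodule Ω).subtypeL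

/-- The embedding of `L²(Ω)` into `H¹(Ω)'`, `v ↦ (w ↦ (v, w))`. -/
def toH1Dual {d : ℕ} {Ω : Set (E d)} (v : L2 Ω) : H1Dual Ω :=
  (innerSL ℝ v).comp (fnL Ω)

/-! ### Functions of time -/

/-- Lebesgue measure on `[0, T]`. Thus `MemLp f p (timeMeasure T)` says that
`f ∈ L^p([0, T]; X)`. -/
abbrev timeMeasure (T : ℝ) : Measure ℝ := volume.restrict (Icc 0 T)

/-- `g` is the weak derivative of `f` on `(0, T)`. -/
def IsWeakTimeDeriv {X : Type*} [NormedAddCommGroup X] [NormedSpace ℝ X] (T : ℝ)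
    (f g : ℝ → X) : Prop :=
  ∀ χ : ℝ → ℝ, ContDiff ℝ ∞ χ → HasCompactSupport χ → tsupport χ ⊆ Ioo 0 T →
    ∫ t in Icc 0 T, deriv χ t • f t = -∫ t in Icc 0 T, χ t • g t

/-- `f(0) = a`, for the representative of `f` that is continuous on `[0, T]`. -/
def HasInitialValue {X : Type*} [NormedAddCommGroup X] (T : ℝ) (f : ℝ → X) (a : X) : Prop :=
  ∃ c : ℝ → X, ContinuousOn c (Icc 0 T) ∧ (∀ᵐ t ∂timeMeasure T, c t = f t) ∧ c 0 = a

/-! ### Strain and divergence of displacements, tensors -/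

/-- Second-order tensors. -/
abbrev Tensor2 (d : ℕ) : Type := Fin d → Fin d → ℝ

/-- Fourth-order tensors. -/
abbrev Tensor4 (d : ℕ) : Type := Fin d → Fin d → Fin d → Fin d → ℝ

/-- `A : B`. -/
def contract {d : ℕ} (A B : Tensor2 d) : ℝ := ∑ i, ∑ j, A i j * B i j

/-- `ℂ A`, with components `∑ₖₗ ℂᵢⱼₖₗ Aₖₗ`. -/
def apply4 {d : ℕ} (C : Tensor4 d) (A : Tensor2 d) : Tensor2 d :=
  fun i j => ∑ k, ∑ l, C i j k l * A k l

/-- The identity tensor. -/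
def idTensor (d : ℕ) : Tensor2 d := fun i j => if i = j then 1 else 0

/-- The linearized strain `ε(u) = (∇u + ∇uᵀ) / 2`. -/
def strain {d : ℕ} {Ω : Set (E d)} (u : H10v Ω) (x : E d) : Tensor2 d :=
  fun i j => (grad (comp u i) x j + grad (comp u j) x i) / 2

/-- The divergence `∇·u`. -/
def divergence {d : ℕ} {Ω : Set (E d)} (u : H10v Ω) (x : E d) : ℝ :=
  ∑ i, grad (comp u i) x i

/-! ### The model without secondary consolidation -/

/-- Material parameters: interfacial tension `γ`, width parameter `ℓ`, double-well potential `Ψ`,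
mobility `m`, permeability `κ`, compressibility coefficient `M`, Biot-Willis coefficient `α`,
stiffness tensor `ℂ = stiff` and eigenstrain `𝒯 = eig`, the last six being functions of the
phase field. -/
structure Model (d : ℕ) where
  γ : ℝ
  ℓ : ℝ
  Ψ : ℝ → ℝ
  m : ℝ → ℝ
  κ : ℝ → ℝ
  M : ℝ → ℝ
  α : ℝ → ℝ
  stiff : ℝ → Tensor4 d
  eig : ℝ → Tensor2 d

/-- `Ψ'` is Lipschitz; `m, κ, M, α` are positive constants; `ℂ` is constant, symmetric and
positive definite; the eigenstrain is given by Vegard's law `𝒯(s) = s ε̂ + ε*`. -/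
structure Model.HomogeneousLaws {d : ℕ} (P : Model d) : Prop where
  differentiable_Ψ : Differentiable ℝ P.Ψ
  lipschitz_Ψ' : ∃ L : ℝ≥0, LipschitzWith L (deriv P.Ψ)
  const_m : ∃ m₀ : ℝ, 0 < m₀ ∧ ∀ s, P.m s = m₀
  const_κ : ∃ κ₀ : ℝ, 0 < κ₀ ∧ ∀ s, P.κ s = κ₀
  const_M : ∃ M₀ : ℝ, 0 < M₀ ∧ ∀ s, P.M s = M₀
  const_α : ∃ α₀ : ℝ, 0 < α₀ ∧ ∀ s, P.α s = α₀
  stiffness : ∃ C₀ : Tensor4 d, (∀ s, P.stiff s = C₀) ∧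
    (∀ i j k l, C₀ i j k l = C₀ j i k l ∧ C₀ i j k l = C₀ i j l k ∧ C₀ i j k l = C₀ k l i j) ∧
    ∃ cmin cmax : ℝ, 0 < cmin ∧ 0 < cmax ∧ ∀ A : Tensor2 d, (∀ i j, A i j = A j i) →
      cmin * contract A A ≤ contract A (apply4 C₀ A) ∧
        contract A (apply4 C₀ A) ≤ cmax * contract A A
  vegard : ∃ εhat εstar : Tensor2 d, (∀ i j, εhat i j = εhat j i) ∧
    (∀ i j, εstar i j = εstar j i) ∧ ∀ s i j, P.eig s i j = εhat i j * s + εstar i j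

/-- The density of `δ_φ ℰₑ` at phase-field value `s` and strain `A`. -/
def Model.dPhiEe {d : ℕ} (P : Model d) (s : ℝ) (A : Tensor2 d) : ℝ :=
  (1 / 2) * contract (A - P.eig s) (apply4 (deriv P.stiff s) (A - P.eig s))
    - contract (deriv P.eig s) (apply4 (P.stiff s) (A - P.eig s))

/-- The density of `δ_φ ℰ_f` at phase-field value `s`, volumetric strain `e`, fluid content `θ`. -/
def Model.dPhiEf {d : ℕ} (P : Model d) (s e θ : ℝ) : ℝ :=
  deriv P.M s / 2 * (θ - P.α s * e) ^ 2 - deriv P.α s * P.M s * (θ - P.α s * e) * e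

/-- The density of `δ_ε ℰₑ`. -/
def Model.dEpsEe {d : ℕ} (P : Model d) (s : ℝ) (A : Tensor2 d) : Tensor2 d :=
  apply4 (P.stiff s) (A - P.eig s)

/-- The density of `δ_ε ℰ_f`. -/
def Model.dEpsEf {d : ℕ} (P : Model d) (s e θ : ℝ) : Tensor2 d :=
  -(P.M s * P.α s * (θ - P.α s * e)) • idTensor d

/-- The density of `δ_θ ℰ_f`, the pore pressure. -/
def Model.dThetaEf {d : ℕ} (P : Model d) (s e θ : ℝ) : ℝ :=
  P.M s * (θ - P.α s * e)

/-- Data: reaction `R`, body force `f`, fluid source `S_f`, initial phase field `φ₀` and initial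
fluid content `θ₀`. -/
structure Data {d : ℕ} (Ω : Set (E d)) where
  R : L2 Ω
  f : HNeg1v Ω
  Sf : L2 Ω
  φ₀ : H1 Ω
  θ₀ : L2 Ω

/-- The unknowns `(φ, μ, u, θ, q)`, as functions of time. -/
structure State {d : ℕ} (Ω : Set (E d)) where
  φ : ℝ → H1 Ω
  μ : ℝ → H1 Ω
  u : ℝ → H10v Ω
  θ : ℝ → L2 Ω
  q : ℝ → L2v Ω

/-- Weak solutions of the Cahn-Hilliard-Biot system on `Ω × [0, T]` without secondary
consolidation. As the viscous term is absent, neither regularity in time nor an initial value of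
`∇·u` is required. The test fluxes in Darcy's law have vanishing normal trace, in accordance with
the boundary condition `q · n = 0`. -/
structure IsWeakSolution {d : ℕ} (Ω : Set (E d)) (T : ℝ) (P : Model d) (D : Data Ω)
    (X : State Ω) : Prop where
  φ_mem : MemLp X.φ ∞ (timeMeasure T)
  μ_mem : MemLp X.μ 2 (timeMeasure T)
  u_mem : MemLp X.u ∞ (timeMeasure T)
  θ_mem : MemLp X.θ ∞ (timeMeasure T)
  q_mem : MemLp X.q 2 (timeMeasure T)
  φ_init : HasInitialValue T (fun t => toH1Dual (fn (X.φ t))) (toH1Dual (fn D.φ₀))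
  θ_init : HasInitialValue T (fun t => toH1Dual (X.θ t)) (toH1Dual D.θ₀)
  /-- `∂ₜφ - ∇·(m(φ)∇μ) = R`, with `∂ₜφ ∈ L²([0, T]; H¹(Ω)')`. -/
  phase : ∃ φ' : ℝ → H1Dual Ω, MemLp φ' 2 (timeMeasure T) ∧
    IsWeakTimeDeriv T (fun t => toH1Dual (fn (X.φ t))) φ' ∧
    ∀ η : ℝ → H1 Ω, MemLp η 2 (timeMeasure T) →
      ∫ t in Icc 0 T, (φ' t (η t)
          + ∫ x in Ω, P.m (fn (X.φ t) x) * inner ℝ (grad (X.μ t) x) (grad (η t) x))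
        = ∫ t in Icc 0 T, inner ℝ D.R (fn (η t))
  /-- `μ = δ_φ ℰ`, where `δ_φ ℰ_i = (γ/ℓ) Ψ'(φ) - γ ℓ Δφ`. -/
  potential : ∀ η : ℝ → H1 Ω, MemLp η 2 (timeMeasure T) →
      ∫ t in Icc 0 T, (inner ℝ (fn (X.μ t)) (fn (η t))
          - (P.γ / P.ℓ * (∫ x in Ω, deriv P.Ψ (fn (X.φ t) x) * fn (η t) x)
              + P.γ * P.ℓ * inner ℝ (grad (X.φ t)) (grad (η t)))
          - (∫ x in Ω, P.dPhiEe (fn (X.φ t) x) (strain (X.u t) x) * fn (η t) x)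
          - ∫ x in Ω, P.dPhiEf (fn (X.φ t) x) (divergence (X.u t) x) (X.θ t x) * fn (η t) x)
        = 0
  /-- `-∇·(δ_ε ℰₑ + δ_ε ℰ_f) = f`. -/
  elasticity : ∀ η : ℝ → H10v Ω, MemLp η 2 (timeMeasure T) →
      ∫ t in Icc 0 T, ((∫ x in Ω, contract (P.dEpsEe (fn (X.φ t) x) (strain (X.u t) x))
            (strain (η t) x))
          + ∫ x in Ω, contract (P.dEpsEf (fn (X.φ t) x) (divergence (X.u t) x) (X.θ t x))
            (strain (η t) x))
        = ∫ t in Icc 0 T, D.f (η t)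
  /-- `∂ₜθ + ∇·q = S_f`, with `∂ₜθ ∈ L²([0, T]; H¹(Ω)')`. -/
  flow : ∃ θ' : ℝ → H1Dual Ω, MemLp θ' 2 (timeMeasure T) ∧
    IsWeakTimeDeriv T (fun t => toH1Dual (X.θ t)) θ' ∧
    ∀ η : ℝ → H1 Ω, MemLp η 2 (timeMeasure T) →
      ∫ t in Icc 0 T, (θ' t (η t) - inner ℝ (X.q t) (grad (η t)))
        = ∫ t in Icc 0 T, inner ℝ D.Sf (fn (η t))
  /-- `κ(φ)⁻¹ q + ∇ δ_θ ℰ_f = 0`. -/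
  darcy : ∀ η : ℝ → HDiv0 Ω, MemLp η 2 (timeMeasure T) →
      ∫ t in Icc 0 T,
        ((∫ x in Ω, (P.κ (fn (X.φ t) x))⁻¹ * inner ℝ (X.q t x) (fluxFn (η t : HDiv Ω) x))
          - ∫ x in Ω, P.dThetaEf (fn (X.φ t) x) (divergence (X.u t) x) (X.θ t x)
              * fluxDiv (η t : HDiv Ω) x)
        = 0

/-- `q ∈ L²([0, T]; H₀(∇·, Ω))`. -/
def HasRegularFlux {d : ℕ} (Ω : Set (E d)) (T : ℝ) (q : ℝ → L2v Ω) : Prop :=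
  ∃ Q : ℝ → HDiv0 Ω, MemLp Q 2 (timeMeasure T) ∧
    ∀ᵐ t ∂timeMeasure T, fluxFn (Q t : HDiv Ω) = q t

end CHB

end

open CHB

/-!
Only the equations for the phase field and for the chemical potential enter the estimate. Let `φ`,
`μ`, `u`, `R` be differences of the two solutions and data. The chemical potential is
`μ = -γ ℓ Δφ + w`, where `w`, the difference of `(γ / ℓ) Ψ'(φ) - ε̂ : ℂ(ε(u) - 𝒯(φ))`, satisfies
`‖w‖ ≤ K (‖φ‖ + ‖u‖_{H¹})` because `Ψ'` is Lipschitz and the elastic term is affine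
(`CHB.Model.HomogeneousLaws.exists_lipschitz_potential`); the fluid energy drops out, since `M` and
`α` are constant. Testing `∂ₜφ - m Δμ = R` with `φ` and the potential equation with
`(m / (γ ℓ)) μ`, both cut off at time `τ`, and adding, the terms `(∇μ, ∇φ)` cancel, and Young's
inequality gives
`‖φ(τ)‖² + β ∫_0^τ ‖μ‖² ≤ B (‖φ₀‖² + ∫_0^T (‖u‖²_{H¹} + ‖R‖²)) + B ∫_0^τ ‖φ‖²`
for almost every `τ`, with `β = m / (γ ℓ)` and `B = 1 + 2 β K²` (`energy_estimate`). Grönwall's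
inequality (`ae_gronwall`) concludes.

The analytic point is `½ ‖φ(τ)‖² ≤ ½ ‖φ₀‖² + ∫_0^τ ⟨∂ₜφ, φ⟩`, for `φ` bounded in `H¹(Ω)` with a weak
time derivative in `H¹(Ω)'`. First, in `H¹(Ω)'` the function `φ` is the primitive of its weak
derivative, with the right initial value (`ae_eq_add_integral_of_isWeakTimeDeriv`). As `φ₀` lies in
`H¹(Ω)`, `φ` extends to negative times by the constant `φ₀`, and
`½ ‖φ(t)‖² - ½ ‖φ(t - η)‖² ≤ ⟨∫_{t-η}^t ∂ₜφ, φ(t)⟩` can be integrated over `(0, τ)` and divided by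
`η`. The left side converges at Lebesgue points `τ`; on the right, Fubini's theorem moves the
average onto the bounded function `φ`, and dominated convergence applies
(`tendsto_integral_backward_average_apply`, `half_norm_sq_le_add_integral`).
-/

open CHB

/-! ### Grönwall's inequality -/

open Filter Topology intervalIntegral in
/-- Grönwall's inequality in integral form, for functions that are merely integrable and satisfy
the inequality almost everywhere. The nonnegative `z` is the dissipation, which is controlled
along with `y`. -/
theorem ae_gronwall {T A B : ℝ} (hT : 0 < T) (hA : 0 ≤ A) (hB : 0 ≤ B) {y z : ℝ → ℝ}
    (hy : IntegrableOn y (Icc 0 T)) (hz : IntegrableOn z (Icc 0 T))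
    (hy0 : ∀ t, 0 ≤ y t) (hz0 : ∀ t, 0 ≤ z t)
    (h : ∀ᵐ t ∂timeMeasure T, y t + ∫ s in 0..t, z s ≤ A + B * ∫ s in 0..t, y s) :
    (∀ᵐ t ∂timeMeasure T, y t ≤ A * Real.exp (B * T)) ∧
      ∫ t in Icc 0 T, z t ≤ A * Real.exp (B * T) := by
  -- extension by zero, so that the primitive of `y` is continuous on all of `ℝ`
  set v : ℝ → ℝ := (Icc 0 T).indicator y with hv
  have hvi : Integrable v := hy.integrable_indicator measurableSet_Icc
  have hvy : ∀ t ∈ Icc 0 T, ∫ s in 0..t, y s = ∫ s in 0..t, v s := by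
    intro t ht
    refine integral_congr fun s hs => ?_
    rw [uIcc_of_le ht.1] at hs
    exact (indicator_of_mem (show s ∈ Icc 0 T from ⟨hs.1, hs.2.trans ht.2⟩) y).symm
  set w : ℝ → ℝ := fun t => A + B * ∫ s in 0..t, v s with hw
  have hwc : Continuous w :=
    continuous_const.add
      (continuous_const.mul (continuous_primitive (fun _ _ => hvi.intervalIntegrable) 0))
  have hzn : ∀ t ∈ Icc 0 T, 0 ≤ ∫ s in 0..t, z s := fun t ht =>
    integral_nonneg ht.1 fun s _ => hz0 s
  have hyw : ∀ᵐ t ∂timeMeasure T, v t ≤ w t := by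
    filter_upwards [h, ae_restrict_mem measurableSet_Icc] with t h1 h2
    rw [hvy t h2] at h1
    have := hzn t h2
    rw [hv, indicator_of_mem h2]
    simp only [hw]; linarith
  -- integrating `y ≤ w` gives `w ≤ G`, and `G` is differentiable everywhere since `w` is continuous
  set G : ℝ → ℝ := fun t => A + B * ∫ s in 0..t, w s with hG
  have hGd : ∀ t, HasDerivAt G (B * w t) t := fun t =>
    ((hwc.integral_hasStrictDerivAt 0 t).hasDerivAt.const_mul B).const_add A
  have hwG : ∀ t ∈ Icc 0 T, w t ≤ G t := by
    intro t ht
    simp only [hw, hG]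
    gcongr
    refine integral_mono_ae_restrict ht.1 hvi.intervalIntegrable (hwc.intervalIntegrable _ _) ?_
    exact ae_restrict_of_ae_restrict_of_subset (Icc_subset_Icc_right ht.2) hyw
  have hGb : ∀ t ∈ Icc 0 T, G t ≤ A * Real.exp (B * T) := by
    intro t ht
    have := le_gronwallBound_of_liminf_deriv_right_le (f := G) (f' := fun t => B * w t) (δ := A)
      (K := B) (ε := 0) (a := 0) (b := T)
      (fun t _ => (hGd t).continuousAt.continuousWithinAt)
      (fun t _ r hr => (hGd t).hasDerivWithinAt.liminf_right_slope_le hr) (by simp [hG])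
      (fun t ht => by
        simpa using mul_le_mul_of_nonneg_left (hwG t ⟨ht.1, ht.2.le⟩) hB) t ht
    rw [gronwallBound_ε0, sub_zero] at this
    refine this.trans ?_
    gcongr
    exact ht.2
  have key : ∀ᵐ t ∂timeMeasure T, y t + ∫ s in 0..t, z s ≤ A * Real.exp (B * T) := by
    filter_upwards [h, ae_restrict_mem measurableSet_Icc] with t h1 h2
    rw [hvy t h2] at h1
    exact h1.trans ((hwG t h2).trans (hGb t h2))
  constructor
  · filter_upwards [key, ae_restrict_mem measurableSet_Icc] with t h1 h2
    linarith [hzn t h2]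
  · -- the bound on `∫_0^t z`, valid for almost every `t`, extends to `t = T` by continuity
    set M := A * Real.exp (B * T)
    have hc : ContinuousOn (fun t => ∫ s in 0..t, z s) (Icc 0 T) := by
      have := continuousOn_primitive_interval (a := 0) (b := T) (f := z) (μ := volume)
        (by rwa [uIcc_of_le hT.le])
      rwa [uIcc_of_le hT.le] at this
    have he : EqOn (fun t => max (∫ s in 0..t, z s) M) (fun _ => M) (Icc 0 T) := by
      refine Measure.eqOn_Icc_of_ae_eq volume hT.ne ?_ (hc.sup continuousOn_const)
        continuousOn_const
      filter_upwards [key] with t h1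
      exact max_eq_right (by linarith [hy0 t])
    have := he (right_mem_Icc.2 hT.le)
    rw [integral_Icc_eq_integral_Ioc, ← integral_of_le hT.le]
    exact max_eq_right_iff.1 this


/-! ### Weak time derivatives -/

open Filter Topology intervalIntegral in
/-- `∫_0^t g` has the weak derivative `g`: Fubini's theorem on the triangle `0 ≤ r ≤ t ≤ T`. -/
theorem integral_deriv_smul_primitive {X : Type*} [NormedAddCommGroup X] [NormedSpace ℝ X]
    [CompleteSpace X] {T : ℝ} {g : ℝ → X} (hg : IntegrableOn g (Icc 0 T)) {χ : ℝ → ℝ}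
    (hχ : ContDiff ℝ ∞ χ) (hχT : tsupport χ ⊆ Ioo 0 T) :
    ∫ t in Icc 0 T, deriv χ t • ∫ r in 0..t, g r = -∫ t in Icc 0 T, χ t • g t := by
  have hdc : Continuous (deriv χ) := hχ.continuous_deriv (by simp)
  have h1 : ∀ t ∈ Icc 0 T, deriv χ t • ∫ r in 0..t, g r
      = ∫ r in Icc 0 T,
        {p : ℝ × ℝ | p.2 ≤ p.1}.indicator (fun p => deriv χ p.1 • g p.2) (t, r) := by
    intro t ht
    rw [integral_of_le ht.1, ← integral_Icc_eq_integral_Ioc, ← MeasureTheory.integral_smul]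
    have : Icc 0 t = Icc 0 T ∩ Iic t := by
      ext r; simp only [mem_Icc, mem_inter_iff, mem_Iic]
      exact ⟨fun h => ⟨⟨h.1, h.2.trans ht.2⟩, h.2⟩, fun h => ⟨h.1.1, h.2⟩⟩
    rw [this, ← setIntegral_indicator measurableSet_Iic]
    rfl
  have h2 : ∀ r ∈ Icc 0 T,
      ∫ t in Icc 0 T, {p : ℝ × ℝ | p.2 ≤ p.1}.indicator (fun p => deriv χ p.1 • g p.2) (t, r)
        = -(χ r • g r) := by
    intro r hr
    have e : (fun t => {p : ℝ × ℝ | p.2 ≤ p.1}.indicator (fun p => deriv χ p.1 • g p.2) (t, r))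
        = (Ici r).indicator (fun t => deriv χ t • g r) := rfl
    have : Icc 0 T ∩ Ici r = Icc r T := by
      ext t; simp only [mem_Icc, mem_inter_iff, mem_Ici]
      exact ⟨fun h => ⟨h.2, h.1.2⟩, fun h => ⟨⟨hr.1.trans h.1, h.2⟩, h.1⟩⟩
    rw [e, setIntegral_indicator measurableSet_Ici, this, _root_.integral_smul_const,
      integral_Icc_eq_integral_Ioc, ← integral_of_le hr.2,
      integral_deriv_eq_sub (fun x _ => (hχ.differentiable (by simp)) x)
        (hdc.intervalIntegrable _ _)]
    have : χ T = 0 := image_eq_zero_of_notMem_tsupport fun h => lt_irrefl _ (hχT h).2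
    rw [this, zero_sub, neg_smul]
  rw [setIntegral_congr_fun measurableSet_Icc h1, integral_integral_swap,
    setIntegral_congr_fun measurableSet_Icc h2, MeasureTheory.integral_neg]
  refine Integrable.indicator ?_ (measurableSet_le measurable_snd measurable_fst)
  exact Integrable.smul_prod (hdc.integrableOn_Icc) hg

/-- The du Bois-Reymond lemma: a function whose weak derivative vanishes is constant. -/
theorem ae_eq_const_of_integral_deriv_smul_eq_zero {X : Type*} [NormedAddCommGroup X]
    [NormedSpace ℝ X] [CompleteSpace X] {T : ℝ} (hT : 0 < T) {f : ℝ → X}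
    (hf : IntegrableOn f (Icc 0 T))
    (h : ∀ χ : ℝ → ℝ, ContDiff ℝ ∞ χ → HasCompactSupport χ → tsupport χ ⊆ Ioo 0 T →
      ∫ t in Icc 0 T, deriv χ t • f t = 0) :
    ∃ k : X, ∀ᵐ t ∂timeMeasure T, f t = k := by
  -- the constant is `∫ ψ₀ f`, for a fixed test function `ψ₀` of integral one
  let b : ContDiffBump (T / 2) := ⟨T / 8, T / 4, by positivity, by linarith⟩
  set ψ₀ := b.normed volume with hψ₀
  have hs₀ : tsupport ψ₀ ⊆ Ioo 0 T := by
    rw [b.tsupport_normed_eq, Real.closedBall_eq_Icc]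
    have hb : b.rOut = T / 4 := rfl
    exact fun x hx => ⟨by linarith [hx.1], by linarith [hx.2]⟩
  have hsm : ∀ {ψ : ℝ → ℝ}, ContDiff ℝ ∞ ψ → IntegrableOn (fun t => ψ t • f t) (Icc 0 T) := by
    intro ψ hψ
    exact hf.continuousOn_smul hψ.continuous.continuousOn isCompact_Icc
  set k := ∫ t in Icc 0 T, ψ₀ t • f t with hk
  refine ⟨k, ?_⟩
  have key : ∀ᵐ t, t ∈ Ioo 0 T → f t - k = 0 := by
    refine isOpen_Ioo.ae_eq_zero_of_integral_contDiff_smul_eq_zero ?_ ?_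
    · exact ((hf.mono_set Ioo_subset_Icc_self).sub
        (integrableOn_const (by simp) (by simp))).locallyIntegrableOn
    intro ψ hψ hψc hψs
    -- `ψ - (∫ ψ) ψ₀` has integral zero, hence is the derivative of a test function `χ`
    set a := ∫ t, ψ t with ha
    set ρ : ℝ → ℝ := fun t => ψ t - a * ψ₀ t with hρ
    have hρs : ContDiff ℝ ∞ ρ := hψ.sub (contDiff_const.mul b.contDiff_normed)
    obtain ⟨l, r, hl, hr, hlr⟩ : ∃ l r, 0 < l ∧ r < T ∧ tsupport ψ ∪ tsupport ψ₀ ⊆ Icc l r := by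
      have hK : IsCompact (tsupport ψ ∪ tsupport ψ₀) :=
        hψc.isCompact.union b.hasCompactSupport_normed
      have hne : (tsupport ψ ∪ tsupport ψ₀).Nonempty := by
        refine ⟨T / 2, Or.inr ?_⟩
        rw [b.tsupport_normed_eq]
        exact Metric.mem_closedBall_self b.rOut_pos.le
      obtain ⟨l, hl, hl'⟩ := hK.exists_isLeast hne
      obtain ⟨r, hr, hr'⟩ := hK.exists_isGreatest hne
      have hsub : tsupport ψ ∪ tsupport ψ₀ ⊆ Ioo 0 T := union_subset hψs hs₀
      exact ⟨l, r, (hsub hl).1, (hsub hr).2, fun x hx => ⟨hl' hx, hr' hx⟩⟩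
    have hρ0 : ∀ t ∉ Icc l r, ρ t = 0 := by
      intro t ht
      have h1 : ψ t = 0 := image_eq_zero_of_notMem_tsupport fun h => ht (hlr (Or.inl h))
      have h2 : ψ₀ t = 0 := image_eq_zero_of_notMem_tsupport fun h => ht (hlr (Or.inr h))
      simp [hρ, h1, h2]
    have hρi : ∫ t, ρ t = 0 := by
      rw [hρ, integral_sub (hψ.continuous.integrable_of_hasCompactSupport hψc)
        (b.integrable_normed.const_mul a), integral_const_mul, b.integral_normed, mul_one, sub_self]
    set χ : ℝ → ℝ := fun x => ∫ t in 0..x, ρ t with hχ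
    have hχd : ∀ x, HasDerivAt χ (ρ x) x := fun x =>
      (hρs.continuous.integral_hasStrictDerivAt 0 x).hasDerivAt
    have hχd' : deriv χ = ρ := funext fun x => (hχd x).deriv
    have hχs : ContDiff ℝ ∞ χ :=
      contDiff_infty_iff_deriv.2 ⟨fun x => (hχd x).differentiableAt, hχd' ▸ hρs⟩
    have hχ0 : ∀ x ∉ Icc l r, χ x = 0 := by
      intro x hx
      rcases lt_or_ge x l with hxl | hxl
      · rw [hχ]
        refine intervalIntegral.integral_zero_ae (ae_of_all _ fun t ht => hρ0 t fun h => ?_)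
        rcases le_total 0 x with h0 | h0
        · rw [uIoc_of_le h0] at ht; linarith [ht.2, h.1]
        · rw [uIoc_of_ge h0] at ht; linarith [ht.2, h.1]
      · have hxr : r < x := lt_of_not_ge fun h => hx ⟨hxl, h⟩
        rw [hχ, ← hρi]
        refine intervalIntegral.integral_eq_integral_of_support_subset fun t ht => ?_
        have : t ∈ Icc l r := by_contra fun h => ht (hρ0 t h)
        exact ⟨by linarith [this.1], by linarith [this.2]⟩
    have hχt : tsupport χ ⊆ Icc l r :=
      closure_minimal (fun x hx => by_contra fun h => hx (hχ0 x h)) isClosed_Icc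
    have h0 := h χ hχs (HasCompactSupport.of_support_subset_isCompact isCompact_Icc
      (subset_closure.trans hχt)) (hχt.trans fun x hx => ⟨hl.trans_le hx.1, hx.2.trans_lt hr⟩)
    have e1 : ∫ t in Icc 0 T, deriv χ t • f t = (∫ t in Icc 0 T, ψ t • f t) - a • k := by
      have hi : IntegrableOn (fun t => a • ψ₀ t • f t) (Icc 0 T) :=
        (hsm b.contDiff_normed).smul a
      rw [hχd', hk, ← integral_smul, ← integral_sub (hsm hψ) hi]
      exact integral_congr_ae (ae_of_all _ fun t => by simp [hρ, sub_smul, mul_smul, hψ₀])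
    have hsupp : ∀ t ∉ Icc 0 T, ψ t = 0 := fun t ht =>
      image_eq_zero_of_notMem_tsupport fun h => ht (Ioo_subset_Icc_self (hψs h))
    have e2 : ∫ t, ψ t • (f t - k) = ∫ t in Icc 0 T, ψ t • (f t - k) :=
      (setIntegral_eq_integral_of_forall_compl_eq_zero fun t ht => by
        rw [hsupp t ht, zero_smul]).symm
    have e3 : a = ∫ t in Icc 0 T, ψ t :=
      (setIntegral_eq_integral_of_forall_compl_eq_zero hsupp).symm
    rw [e2]
    simp_rw [smul_sub]
    rw [integral_sub (hsm hψ) (hψ.continuous.integrableOn_Icc.smul_const k), integral_smul_const,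
      ← e3, ← e1, h0]
  rw [timeMeasure, ← restrict_Ioo_eq_restrict_Icc, ae_restrict_iff' measurableSet_Ioo]
  filter_upwards [key] with t ht h
  exact sub_eq_zero.1 (ht h)

/-- A function with an integrable weak derivative is the primitive of that derivative; the constant
of integration is the value at `0` of the continuous representative. -/
theorem ae_eq_add_integral_of_isWeakTimeDeriv {X : Type*} [NormedAddCommGroup X]
    [NormedSpace ℝ X] [CompleteSpace X] {T : ℝ} (hT : 0 < T) {f g : ℝ → X} {a : X}
    (hf : IntegrableOn f (Icc 0 T)) (hg : IntegrableOn g (Icc 0 T))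
    (hfg : IsWeakTimeDeriv T f g) (ha : HasInitialValue T f a) :
    ∀ᵐ t ∂timeMeasure T, f t = a + ∫ s in 0..t, g s := by
  have hc : ContinuousOn (fun t => ∫ s in 0..t, g s) (Icc 0 T) := by
    have := intervalIntegral.continuousOn_primitive_interval (a := 0) (b := T) (f := g)
      (μ := volume) (by rwa [uIcc_of_le hT.le])
    rwa [uIcc_of_le hT.le] at this
  obtain ⟨k, hk⟩ := ae_eq_const_of_integral_deriv_smul_eq_zero hT
    (f := fun t => f t - ∫ s in 0..t, g s) (hf.sub hc.integrableOn_Icc) (by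
      intro χ hχ hχc hχs
      have hd : ContinuousOn (deriv χ) (Icc 0 T) := (hχ.continuous_deriv (by simp)).continuousOn
      have hi : IntegrableOn (fun t => deriv χ t • ∫ s in 0..t, g s) (Icc 0 T) :=
        (hd.smul hc).integrableOn_Icc
      simp_rw [smul_sub]
      rw [integral_sub (hf.continuousOn_smul hd isCompact_Icc) hi,
        hfg χ hχ hχc hχs, integral_deriv_smul_primitive hg hχ hχs, sub_self])
  obtain ⟨c, hcc, hcf, rfl⟩ := ha
  -- both sides are continuous representatives of `f`, so they agree at every time, also at `0`
  have he : EqOn c (fun t => k + ∫ s in 0..t, g s) (Icc 0 T) := by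
    refine Measure.eqOn_Icc_of_ae_eq volume hT.ne ?_ hcc (continuousOn_const.add hc)
    filter_upwards [hk, hcf] with t h1 h2
    rw [h2, ← h1, sub_add_cancel]
  have h0 : c 0 = k := by simpa using he (left_mem_Icc.2 hT.le)
  filter_upwards [hk] with t h1
  rw [h0, ← h1, sub_add_cancel]

/-! ### The energy inequality for the time derivative -/

open Filter Topology IsUnifLocDoublingMeasure in
/-- Forward averages converge at Lebesgue points. The set of good points does not depend on the
functional `ℓ`, and `V` need not be complete, as only averages of `‖ψ t - ψ s‖` are used. -/
theorem ae_tendsto_forward_average_apply {V : Type*} [NormedAddCommGroup V] [NormedSpace ℝ V]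
    {ψ : ℝ → V} (hψ : LocallyIntegrable ψ) :
    ∀ᵐ s, ∀ ℓ : StrongDual ℝ V,
      Tendsto (fun h => h⁻¹ * ∫ t in Icc s (s + h), ℓ (ψ t)) (𝓝[>] 0) (𝓝 (ℓ (ψ s))) := by
  filter_upwards [(vitaliFamily (volume : Measure ℝ) 1).ae_tendsto_average_norm_sub hψ] with s hs ℓ
  have hm : Tendsto (fun h => s + h) (𝓝[>] (0 : ℝ)) (𝓝[>] s) := by
    refine tendsto_nhdsWithin_iff.2 ⟨?_, ?_⟩
    · have : Tendsto (fun h => s + h) (𝓝 (0 : ℝ)) (𝓝 (s + 0)) := by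
        exact (continuous_const.add continuous_id).tendsto 0
      rw [add_zero] at this
      exact this.mono_left nhdsWithin_le_nhds
    · filter_upwards [self_mem_nhdsWithin] with h hh
      exact lt_add_of_pos_right s hh
  have h1 := ((hs.comp (Real.tendsto_Icc_vitaliFamily_right s)).comp hm).const_mul ‖ℓ‖
  rw [mul_zero] at h1
  rw [tendsto_iff_norm_sub_tendsto_zero]
  refine squeeze_zero' (Eventually.of_forall fun _ => norm_nonneg _) ?_ h1
  filter_upwards [self_mem_nhdsWithin] with h (hh : 0 < h)
  have hi : IntegrableOn ψ (Icc s (s + h)) := hψ.integrableOn_isCompact isCompact_Icc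
  have hc : IntegrableOn (fun _ => ψ s) (Icc s (s + h)) :=
    integrableOn_const (by simp) (by simp)
  have e : h⁻¹ * (∫ t in Icc s (s + h), ℓ (ψ t)) - ℓ (ψ s)
      = h⁻¹ * ∫ t in Icc s (s + h), ℓ (ψ t - ψ s) := by
    simp_rw [map_sub]
    rw [integral_sub (ℓ.integrable_comp hi) (ℓ.integrable_comp hc), mul_sub]
    simp [hh.le, hh.ne']
  rw [e, norm_mul, Real.norm_of_nonneg (inv_nonneg.2 hh.le)]
  simp only [Function.comp, average_eq, smul_eq_mul]
  have hv : (volume.restrict (Icc s (s + h))).real univ = h := by simp [hh.le]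
  rw [hv, mul_left_comm]
  refine mul_le_mul_of_nonneg_left ?_ (inv_nonneg.2 hh.le)
  rw [← integral_const_mul]
  exact norm_integral_le_of_norm_le ((hi.sub hc).norm.const_mul _)
    (ae_of_all _ fun t => ℓ.le_opNorm _)

/-- A measurable field of functionals, applied to a measurable field of vectors. -/
theorem aestronglyMeasurable_apply {α V : Type*} [MeasurableSpace α] {μ : Measure α}
    [NormedAddCommGroup V] [NormedSpace ℝ V] {G : α → StrongDual ℝ V} {ψ : α → V}
    (hG : AEStronglyMeasurable G μ) (hψ : AEStronglyMeasurable ψ μ) :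
    AEStronglyMeasurable (fun t => G t (ψ t)) μ :=
  (isBoundedBilinearMap_apply (𝕜 := ℝ) (E := V) (F := ℝ)).continuous.comp_aestronglyMeasurable
    (hG.prodMk hψ)

/-- The strip `t - h < s ≤ t` in the `(t, s)`-plane. Its sections are the intervals of a backward
average at time `t` and of a forward average at time `s`, which Fubini's theorem exchanges. -/
theorem measurableSet_strip (h : ℝ) : MeasurableSet {p : ℝ × ℝ | p.1 - h < p.2 ∧ p.2 ≤ p.1} :=
  (measurableSet_lt (measurable_fst.sub_const h) measurable_snd).inter
    (measurableSet_le measurable_snd measurable_fst)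

theorem integrable_indicator_strip_apply {V : Type*} [NormedAddCommGroup V]
    [NormedSpace ℝ V] {G : ℝ → StrongDual ℝ V} (hG : Integrable G) {ψ : ℝ → V}
    (hψ : Integrable ψ) (h : ℝ) :
    Integrable ({p : ℝ × ℝ | p.1 - h < p.2 ∧ p.2 ≤ p.1}.indicator (fun p => G p.2 (ψ p.1)))
      (volume.prod volume) := by
  refine Integrable.indicator ?_ (measurableSet_strip h)
  refine (hψ.norm.mul_prod hG.norm).mono' ?_ (ae_of_all _ fun p => ?_)
  · exact aestronglyMeasurable_apply hG.aestronglyMeasurable.comp_snd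
      hψ.aestronglyMeasurable.comp_fst
  · rw [mul_comm]; exact (G p.2).le_opNorm _

theorem integral_Ioc_apply_eq_integral_strip {V : Type*} [NormedAddCommGroup V]
    [NormedSpace ℝ V] (G : ℝ → StrongDual ℝ V) (ψ : ℝ → V) (h t : ℝ) :
    ∫ s in Ioc (t - h) t, G s (ψ t) = ∫ s, {p : ℝ × ℝ | p.1 - h < p.2 ∧ p.2 ≤ p.1}.indicator
      (fun p => G p.2 (ψ p.1)) (t, s) := by
  rw [← integral_indicator measurableSet_Ioc]
  rfl

theorem integral_Ico_apply_eq_integral_strip {V : Type*} [NormedAddCommGroup V]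
    [NormedSpace ℝ V] (G : ℝ → StrongDual ℝ V) (ψ : ℝ → V) (h s : ℝ) :
    ∫ t in Ico s (s + h), G s (ψ t) = ∫ t, {p : ℝ × ℝ | p.1 - h < p.2 ∧ p.2 ≤ p.1}.indicator
      (fun p => G p.2 (ψ p.1)) (t, s) := by
  rw [← integral_indicator measurableSet_Ico]
  refine integral_congr_ae (ae_of_all _ fun t => ?_)
  have : t ∈ Ico s (s + h) ↔ t - h < s ∧ s ≤ t := by
    rw [mem_Ico, and_comm, sub_lt_iff_lt_add]
  simp only [indicator, this, mem_ofPred_eq]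

theorem integrable_integral_Ioc_apply {V : Type*} [NormedAddCommGroup V]
    [NormedSpace ℝ V] {G : ℝ → StrongDual ℝ V} (hG : Integrable G) {ψ : ℝ → V}
    (hψ : Integrable ψ) (h : ℝ) :
    Integrable (fun t => ∫ s in Ioc (t - h) t, G s (ψ t)) := by
  simp_rw [integral_Ioc_apply_eq_integral_strip]
  exact (integrable_indicator_strip_apply hG hψ h).integral_prod_left

open Filter Topology in
/-- The pairing of the backward averages of an integrable `G` with a bounded `ψ` converges to the
pairing of `G` with `ψ`. By Fubini's theorem the averaging falls on `ψ`, where boundedness gives a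
dominating function; no maximal function is needed. -/
theorem tendsto_integral_backward_average_apply {V : Type*} [NormedAddCommGroup V]
    [NormedSpace ℝ V] {G : ℝ → StrongDual ℝ V} (hG : Integrable G) {ψ : ℝ → V}
    (hψ : Integrable ψ) {K : ℝ} (hK : ∀ᵐ t, ‖ψ t‖ ≤ K) :
    Tendsto (fun h => h⁻¹ * ∫ t, ∫ s in Ioc (t - h) t, G s (ψ t)) (𝓝[>] 0)
      (𝓝 (∫ s, G s (ψ s))) := by
  have hswap : ∀ h : ℝ, h⁻¹ * ∫ t, ∫ s in Ioc (t - h) t, G s (ψ t)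
      = ∫ s, h⁻¹ * ∫ t in Ico s (s + h), G s (ψ t) := by
    intro h
    simp_rw [integral_Ioc_apply_eq_integral_strip, integral_Ico_apply_eq_integral_strip]
    rw [integral_const_mul]
    congr 1
    exact integral_integral_swap (f := fun t s => {p : ℝ × ℝ | p.1 - h < p.2 ∧ p.2 ≤ p.1}.indicator
      (fun p => G p.2 (ψ p.1)) (t, s)) (integrable_indicator_strip_apply hG hψ h)
  simp_rw [hswap]
  refine tendsto_integral_filter_of_dominated_convergence (fun s => K * ‖G s‖) ?_ ?_
    (hG.norm.const_mul K) ?_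
  · refine Eventually.of_forall fun h => ?_
    simp_rw [integral_Ico_apply_eq_integral_strip]
    have := (integrable_indicator_strip_apply hG hψ h).integral_prod_right
    exact this.aestronglyMeasurable.const_mul _
  · filter_upwards [self_mem_nhdsWithin] with h (hh : 0 < h)
    refine ae_of_all _ fun s => ?_
    have : ‖∫ t in Ico s (s + h), G s (ψ t)‖ ≤ (K * ‖G s‖) * h := by
      have := norm_setIntegral_le_of_norm_le_const_ae (μ := volume) (s := Ico s (s + h))
        (f := fun t => G s (ψ t)) (C := K * ‖G s‖) (by simp) (by
          filter_upwards [ae_restrict_of_ae hK] with t ht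
          rw [mul_comm]
          exact (G s).le_of_opNorm_le_of_le le_rfl ht)
      simpa [hh.le] using this
    rw [norm_mul, Real.norm_of_nonneg (inv_nonneg.2 hh.le), inv_mul_le_iff₀ hh]
    linarith
  · filter_upwards [ae_tendsto_forward_average_apply hψ.locallyIntegrable] with s hs
    have := hs (G s)
    simp_rw [integral_Icc_eq_integral_Ico] at this
    exact this

theorem exists_ae_norm_le_of_memLp_top {α V : Type*} [MeasurableSpace α] {μ : Measure α}
    [NormedAddCommGroup V] {φ : α → V} (hφ : MemLp φ ⊤ μ) : ∃ K, ∀ᵐ t ∂μ, ‖φ t‖ ≤ K := by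
  have hfin : eLpNormEssSup φ μ ≠ ⊤ := by
    rw [← eLpNorm_exponent_top]; exact hφ.2.ne
  refine ⟨(eLpNormEssSup φ μ).toReal, ?_⟩
  filter_upwards [ae_le_eLpNormEssSup (f := φ) (μ := μ)] with t ht
  rw [← toReal_enorm]
  exact ENNReal.toReal_mono hfin ht

theorem integrable_indicator_of_integrableOn {α X : Type*} [MeasurableSpace α] {μ : Measure α}
    [NormedAddCommGroup X] {g : α → X} {s : Set α} (hs : MeasurableSet s)
    (hg : IntegrableOn g s μ) : Integrable (s.indicator g) μ :=
  (integrable_indicator_iff hs).2 hg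

open Filter Topology in
/-- The energy inequality behind `⟨∂ₜφ, φ⟩ = ½ d/dt ‖φ‖²` in a triple `V → H → V'`. The inequality
`½‖a‖² - ½‖b‖² ≤ (a - b, a)`, applied to `φ` at the times `t` and `t - η`, is integrated over
`t ∈ (0, τ)` and divided by `η`; then `η → 0`. -/
theorem half_norm_sq_le_add_integral {V H : Type*} [NormedAddCommGroup V] [NormedSpace ℝ V]
    [NormedAddCommGroup H] [InnerProductSpace ℝ H] (j : V →L[ℝ] H) {T : ℝ}
    {φ : ℝ → V} (hφ : MemLp φ ⊤ (timeMeasure T)) {g : ℝ → StrongDual ℝ V}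
    (hg : IntegrableOn g (Icc 0 T)) (v₀ : V)
    (h : ∀ᵐ t ∂timeMeasure T,
      (innerSL ℝ (j (φ t))).comp j = (innerSL ℝ (j v₀)).comp j + ∫ s in 0..t, g s) :
    ∀ᵐ τ ∂timeMeasure T, ‖j (φ τ)‖ ^ 2 / 2 ≤ ‖j v₀‖ ^ 2 / 2 + ∫ t in 0..τ, g t (φ t) := by
  rw [timeMeasure, ← restrict_Ioc_eq_restrict_Icc] at hφ h ⊢
  -- extension to negative times by the initial value, and of `g` by zero
  set Φ : ℝ → V := (Ioc 0 T).piecewise φ (fun _ => v₀) with hΦ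
  set G : ℝ → StrongDual ℝ V := (Ioc 0 T).indicator g with hGdef
  have hGi : Integrable G :=
    integrable_indicator_of_integrableOn measurableSet_Ioc (hg.mono_set Ioc_subset_Icc_self)
  have hΦneg : ∀ t ≤ 0, Φ t = v₀ := fun t ht =>
    piecewise_eq_of_notMem _ _ _ fun hm => hm.1.not_ge ht
  have hΦpos : ∀ t ∈ Ioc 0 T, Φ t = φ t := fun t ht => piecewise_eq_of_mem _ _ _ ht
  obtain ⟨K, hK⟩ : ∃ K, ∀ᵐ t, ‖Φ t‖ ≤ K := by
    obtain ⟨K, hK⟩ := exists_ae_norm_le_of_memLp_top hφ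
    rw [ae_restrict_iff' measurableSet_Ioc] at hK
    refine ⟨max K ‖v₀‖, ?_⟩
    filter_upwards [hK] with t ht
    by_cases hm : t ∈ Ioc 0 T
    · rw [hΦpos t hm]; exact (ht hm).trans (le_max_left _ _)
    · rw [hΦ, piecewise_eq_of_notMem _ _ _ hm]; exact le_max_right _ _
  have hΦm : AEStronglyMeasurable Φ volume :=
    AEStronglyMeasurable.piecewise measurableSet_Ioc hφ.aestronglyMeasurable
      aestronglyMeasurable_const
  have hΦl : LocallyIntegrable Φ :=
    (locallyIntegrable_const K).mono hΦm (by
      filter_upwards [hK] with t ht using ht.trans (le_abs_self K))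
  set J : V → StrongDual ℝ V := fun v => (innerSL ℝ (j v)).comp j with hJ
  have hJΦ : ∀ᵐ t, t ≤ T → J (Φ t) = J v₀ + ∫ s in 0..t, G s := by
    rw [ae_restrict_iff' measurableSet_Ioc] at h
    filter_upwards [h] with t ht htT
    rcases lt_or_ge 0 t with h0 | h0
    · have e : ∫ s in 0..t, G s = ∫ s in 0..t, g s := by
        refine intervalIntegral.integral_congr_ae (ae_of_all _ fun s hs => ?_)
        rw [uIoc_of_le h0.le] at hs
        exact indicator_of_mem (show s ∈ Ioc 0 T from ⟨hs.1, hs.2.trans htT⟩) g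
      rw [e, hΦpos t ⟨h0, htT⟩]
      exact ht ⟨h0, htT⟩
    · have e : ∫ s in 0..t, G s = 0 := by
        refine intervalIntegral.integral_zero_ae (ae_of_all _ fun s hs => ?_)
        rw [uIoc_of_ge h0] at hs
        exact indicator_of_notMem (fun hm => hm.1.not_ge hs.2) g
      rw [e, add_zero, hΦneg t h0]
  have hE : ∀ v w : V, ‖j v‖ ^ 2 / 2 - ‖j w‖ ^ 2 / 2 ≤ (J v - J w) v := by
    intro v w
    have h1 := norm_sub_sq_real (j v) (j w)
    have h2 : (J v - J w) v = ‖j v‖ ^ 2 - inner ℝ (j w) (j v) := by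
      simp [hJ]
    rw [h2, real_inner_comm]
    nlinarith [sq_nonneg ‖j v - j w‖]
  set e : ℝ → ℝ := fun t => ‖j (Φ t)‖ ^ 2 / 2 with he
  have hei : LocallyIntegrable e := by
    refine (locallyIntegrable_const ((‖j‖ * K) ^ 2 / 2)).mono
      (((j.continuous.comp_aestronglyMeasurable hΦm).norm.pow 2).mul_const _) ?_
    filter_upwards [hK] with t ht
    rw [Real.norm_of_nonneg (by positivity), Real.norm_of_nonneg (by positivity)]
    simp only [he]
    gcongr
    exact j.le_of_opNorm_le_of_le le_rfl ht
  have heii : ∀ a b, IntervalIntegrable e volume a b := fun a b =>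
    (hei.integrableOn_isCompact isCompact_uIcc).intervalIntegrable
  -- the energy increment over a step of length `η`
  have hstep : ∀ η > 0, ∀ᵐ t, t ≤ T → e t - e (t - η) ≤ ∫ s in Ioc (t - η) t, G s (Φ t) := by
    intro η hη
    have hshift : ∀ᵐ t, t - η ≤ T → J (Φ (t - η)) = J v₀ + ∫ s in 0..(t - η), G s :=
      (measurePreserving_sub_right volume η).quasiMeasurePreserving.ae hJΦ
    filter_upwards [hJΦ, hshift] with t h1 h2 htT
    refine (hE _ _).trans (le_of_eq ?_)
    rw [h1 htT, h2 (by linarith), add_sub_add_left_eq_sub,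
      intervalIntegral.integral_interval_sub_left hGi.intervalIntegrable hGi.intervalIntegrable,
      intervalIntegral.integral_of_le (by linarith)]
    exact ContinuousLinearMap.integral_apply hGi.integrableOn _
  filter_upwards [ae_restrict_of_ae (_root_.LocallyIntegrable.ae_hasDerivAt_integral hei),
    ae_restrict_mem measurableSet_Ioc] with τ hτ hτT
  set ψ : ℝ → V := (Ioc 0 τ).indicator Φ with hψ
  have hψi : Integrable ψ :=
    integrable_indicator_of_integrableOn measurableSet_Ioc
      ((hΦl.integrableOn_isCompact isCompact_Icc).mono_set Ioc_subset_Icc_self)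
  have hψK : ∀ᵐ t, ‖ψ t‖ ≤ K := by
    filter_upwards [hK] with t ht
    exact (norm_indicator_le_norm_self _ _).trans ht
  have hR := tendsto_integral_backward_average_apply hGi hψi hψK
  have hR' : ∫ s, G s (ψ s) = ∫ t in 0..τ, g t (φ t) := by
    rw [intervalIntegral.integral_of_le hτT.1.le, ← integral_indicator measurableSet_Ioc]
    refine integral_congr_ae (ae_of_all _ fun s => ?_)
    by_cases hs : s ∈ Ioc 0 τ
    · have hs' : s ∈ Ioc 0 T := ⟨hs.1, hs.2.trans hτT.2⟩
      simp only [hψ, indicator_of_mem hs, hGdef, indicator_of_mem hs', hΦpos s hs']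
    · simp only [hψ, indicator_of_notMem hs, map_zero]
  have hL : Tendsto (fun η => η⁻¹ * (∫ t in (τ - η)..τ, e t)) (𝓝[>] 0) (𝓝 (e τ)) := by
    have hneg : Tendsto (fun η : ℝ => -η) (𝓝[>] 0) (𝓝[<] 0) := by
      simpa using tendsto_neg_nhdsGT_neg (a := (0 : ℝ))
    refine ((hτ 0).tendsto_slope_zero_left.comp hneg).congr fun η => ?_
    simp only [Function.comp, ← sub_eq_add_neg, smul_eq_mul]
    rw [intervalIntegral.integral_interval_sub_left (heii _ _) (heii _ _),
      intervalIntegral.integral_symm, inv_neg, neg_mul_neg]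
  have hes : ∀ η, IntervalIntegrable (fun t => e (t - η)) volume 0 τ := fun η => by
    simpa using (heii (0 - η) (τ - η)).comp_sub_right η enorm_ne_top
  have hle : ∀ᶠ η in 𝓝[>] (0 : ℝ), η⁻¹ * (∫ t in (τ - η)..τ, e t) - ‖j v₀‖ ^ 2 / 2
      ≤ η⁻¹ * ∫ t, ∫ s in Ioc (t - η) t, G s (ψ t) := by
    filter_upwards [self_mem_nhdsWithin] with η (hη : 0 < η)
    have h0 : ∫ t in (-η)..0, e t = η * (‖j v₀‖ ^ 2 / 2) := by
      rw [intervalIntegral.integral_congr (g := fun _ => ‖j v₀‖ ^ 2 / 2)]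
      · rw [intervalIntegral.integral_const, zero_sub, neg_neg, smul_eq_mul]
      · intro t ht
        rw [uIcc_of_le (by linarith)] at ht
        simp only [he, hΦneg t ht.2]
    have h1 : ∫ t in 0..τ, (e t - e (t - η)) ≤ ∫ t, ∫ s in Ioc (t - η) t, G s (ψ t) := by
      have hint := integrable_integral_Ioc_apply hGi hψi η
      have e1 : ∫ t, ∫ s in Ioc (t - η) t, G s (ψ t)
          = ∫ t in Ioc 0 τ, ∫ s in Ioc (t - η) t, G s (ψ t) := by
        refine (setIntegral_eq_integral_of_forall_compl_eq_zero fun t ht => ?_).symm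
        simp [hψ, indicator_of_notMem ht]
      rw [e1, intervalIntegral.integral_of_le hτT.1.le]
      refine setIntegral_mono_on_ae ?_ hint.integrableOn measurableSet_Ioc ?_
      · exact ((heii 0 τ).sub (hes η)).1
      · filter_upwards [hstep η hη] with t ht htm
        rw [hψ, indicator_of_mem htm]
        exact ht (htm.2.trans hτT.2)
    have h2 : ∫ t in 0..τ, (e t - e (t - η)) = (∫ t in (τ - η)..τ, e t) - ∫ t in (-η)..0, e t := by
      rw [intervalIntegral.integral_sub (heii _ _) (hes η),
        intervalIntegral.integral_comp_sub_right,
        intervalIntegral.integral_interval_sub_interval_comm' (heii _ _) (heii _ _) (heii _ _),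
        zero_sub]
    rw [h2, h0] at h1
    have := mul_le_mul_of_nonneg_left h1 (inv_nonneg.2 hη.le)
    rwa [mul_sub, inv_mul_cancel_left₀ hη.ne'] at this
  have := le_of_tendsto_of_tendsto (hL.sub_const _) hR hle
  rw [hR'] at this
  have hτe : e τ = ‖j (φ τ)‖ ^ 2 / 2 := by
    simp only [he, hΦpos τ hτT]
  linarith

/-! ### The chemical potential as a Lipschitz map -/

/-- The map `w ↦ ∇w` from `H¹(Ω)` to `L²(Ω)ᵈ`. -/
noncomputable def gradL {d : ℕ} (Ω : Set (E d)) : H1 Ω →L[ℝ] L2v Ω :=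
  (WithLp.sndL 2 ℝ (L2 Ω) (L2v Ω)).comp (H1Submodule Ω).subtypeL

theorem fnL_apply {d : ℕ} {Ω : Set (E d)} (w : H1 Ω) : fnL Ω w = fn w := rfl

theorem gradL_apply {d : ℕ} {Ω : Set (E d)} (w : H1 Ω) : gradL Ω w = grad w := rfl

/-- The map `u ↦ uₖ` from `H¹₀(Ω)ᵈ` to `H¹(Ω)`. -/
noncomputable def compL {d : ℕ} (Ω : Set (E d)) (k : Fin d) : H10v Ω →L[ℝ] H1 Ω :=
  (H10 Ω).subtypeL.comp (PiLp.proj 2 (fun _ : Fin d => H10 Ω) k)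

/-- The map `u ↦ ∂ₗuₖ` from `H¹₀(Ω)ᵈ` to `L²(Ω)`. -/
noncomputable def partialL {d : ℕ} (Ω : Set (E d)) (k l : Fin d) : H10v Ω →L[ℝ] L2 Ω :=
  ((EuclideanSpace.proj (𝕜 := ℝ) l).compLpL 2 (volume.restrict Ω)).comp
    ((gradL Ω).comp (compL Ω k))

theorem coeFn_partialL {d : ℕ} {Ω : Set (E d)} (k l : Fin d) (u : H10v Ω) :
    partialL Ω k l u =ᵐ[volume.restrict Ω] fun x => grad (comp u k) x l :=
  ContinuousLinearMap.coeFn_compLpL _ _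

theorem coeFn_sum_smul {α ι : Type*} [MeasurableSpace α] {μ : Measure α} (s : Finset ι)
    (c : ι → ℝ) (F : ι → Lp ℝ 2 μ) :
    (∑ p ∈ s, c p • F p : Lp ℝ 2 μ) =ᵐ[μ] fun x => ∑ p ∈ s, c p * F p x := by
  have h := ae_all_iff.2 fun p : s => Lp.coeFn_smul (c p) (F p)
  filter_upwards [Lp.coeFn_fun_finsetSum s fun p => c p • F p, h] with x h1 h2
  rw [h1]
  exact Finset.sum_congr rfl fun p hp => by simpa using h2 ⟨p, hp⟩

theorem contract_apply4 {d : ℕ} (B : Tensor2 d) (C : Tensor4 d) (A : Tensor2 d) :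
    contract B (apply4 C A) = ∑ k, ∑ l, (∑ i, ∑ j, B i j * C i j k l) * A k l := by
  simp only [contract, apply4, Finset.mul_sum, Finset.sum_mul]
  have h1 : ∀ i, ∑ j, ∑ k, ∑ l, B i j * (C i j k l * A k l)
      = ∑ k, ∑ l, ∑ j, B i j * (C i j k l * A k l) := fun i => by
    rw [Finset.sum_comm]
    exact Finset.sum_congr rfl fun k _ => Finset.sum_comm
  simp_rw [h1]
  rw [Finset.sum_comm]
  refine Finset.sum_congr rfl fun k _ => ?_
  rw [Finset.sum_comm]
  simp only [mul_assoc]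

theorem CHB.Model.HomogeneousLaws.dPhiEf_eq_zero {d : ℕ} {P : Model d} (hP : P.HomogeneousLaws)
    (s e θ : ℝ) : P.dPhiEf s e θ = 0 := by
  obtain ⟨M₀, -, hM⟩ := hP.const_M
  obtain ⟨α₀, -, hα⟩ := hP.const_α
  simp [Model.dPhiEf, funext hM, funext hα]

/-- For constant stiffness and Vegard's law, `δ_φ ℰₑ = -ε̂ : ℂ(A - s ε̂ - ε*)` is affine in the
phase field and the strain. -/
theorem CHB.Model.HomogeneousLaws.exists_dPhiEe_eq {d : ℕ} {P : Model d} (hP : P.HomogeneousLaws) :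
    ∃ (b : Fin d → Fin d → ℝ) (β c : ℝ), ∀ s (A : Tensor2 d),
      P.dPhiEe s A = β * s + c - ∑ k, ∑ l, b k l * A k l := by
  obtain ⟨C₀, hC, -, -⟩ := hP.stiffness
  obtain ⟨a, a', -, -, ha⟩ := hP.vegard
  have hC' : P.stiff = fun _ => C₀ := funext hC
  have hd : ∀ s, deriv P.eig s = a := fun s => by
    have h1 : P.eig = fun s i j => a i j * s + a' i j := by
      funext s i j; exact ha s i j
    rw [h1]
    refine HasDerivAt.deriv (hasDerivAt_pi.2 fun i => hasDerivAt_pi.2 fun j => ?_)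
    simpa using ((hasDerivAt_id s).const_mul (a i j)).add_const (a' i j)
  refine ⟨fun k l => ∑ i, ∑ j, a i j * C₀ i j k l,
    ∑ k, ∑ l, (∑ i, ∑ j, a i j * C₀ i j k l) * a k l,
    ∑ k, ∑ l, (∑ i, ∑ j, a i j * C₀ i j k l) * a' k l, fun s A => ?_⟩
  have h0 : apply4 (0 : Tensor4 d) (A - P.eig s) = 0 := by
    funext i j; simp [apply4]
  have h0' : contract (A - P.eig s) (0 : Tensor2 d) = 0 := by simp [contract]
  rw [Model.dPhiEe, hd, hC', deriv_const, h0, h0', contract_apply4, mul_zero, zero_sub,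
    ← Finset.sum_neg_distrib, Finset.sum_mul, ← Finset.sum_add_distrib, ← Finset.sum_sub_distrib]
  refine Finset.sum_congr rfl fun k _ => ?_
  rw [← Finset.sum_neg_distrib, Finset.sum_mul, ← Finset.sum_add_distrib,
    ← Finset.sum_sub_distrib]
  refine Finset.sum_congr rfl fun l _ => ?_
  simp only [Pi.sub_apply, ha]
  ring

theorem isFiniteMeasure_restrict_of_isBounded {d : ℕ} {Ω : Set (E d)}
    (hΩ : Bornology.IsBounded Ω) : IsFiniteMeasure (volume.restrict Ω) :=
  ⟨by rw [Measure.restrict_apply_univ]; exact hΩ.measure_lt_top⟩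

/-- The part of the chemical potential without derivatives of the phase field defines a Lipschitz
map `L²(Ω) × H¹₀(Ω)ᵈ → L²(Ω)`, by the Lipschitz continuity of `Ψ'`. -/
theorem CHB.Model.HomogeneousLaws.exists_lipschitz_potential {d : ℕ} {Ω : Set (E d)}
    (hΩ : Bornology.IsBounded Ω) {P : Model d} (hP : P.HomogeneousLaws) :
    ∃ (W : L2 Ω → H10v Ω → L2 Ω) (K : ℝ),
      (∀ v w u z, ‖W v u - W w z‖ ≤ K * (‖v - w‖ + ‖u - z‖)) ∧
      ∀ v u, W v u =ᵐ[volume.restrict Ω]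
        fun x => P.γ / P.ℓ * deriv P.Ψ (v x) + P.dPhiEe (v x) (strain u x) := by
  have := isFiniteMeasure_restrict_of_isBounded hΩ
  obtain ⟨L, hL⟩ := hP.lipschitz_Ψ'
  obtain ⟨b, β, c, hb⟩ := hP.exists_dPhiEe_eq
  -- `Ψ'` is split as a Lipschitz function vanishing at `0` and a constant
  set g : ℝ → ℝ := fun s => deriv P.Ψ s - deriv P.Ψ 0 with hg
  have hgL : LipschitzWith L g := by
    have := hL.sub (LipschitzWith.const (deriv P.Ψ 0))
    rwa [add_zero] at this
  have hg0 : g 0 = 0 := sub_self _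
  -- by symmetrization, `∑ bₖₗ ε(u)ₖₗ` is a combination of the partial derivatives of `u`
  set D : Fin d × Fin d → ℝ := fun p => (b p.1 p.2 + b p.2 p.1) / 2 with hD
  set S : H10v Ω →L[ℝ] L2 Ω := ∑ p, D p • partialL Ω p.1 p.2 with hS
  set q : L2 Ω := (memLp_const (P.γ / P.ℓ * deriv P.Ψ 0 + c)).toLp
    (fun _ => P.γ / P.ℓ * deriv P.Ψ 0 + c) with hq
  refine ⟨fun v u => (P.γ / P.ℓ) • hgL.compLp hg0 v + β • v - S u + q,
    |P.γ / P.ℓ| * L + |β| + ‖S‖, fun v w u z => ?_, fun v u => ?_⟩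
  · have e : (P.γ / P.ℓ) • hgL.compLp hg0 v + β • v - S u + q
        - ((P.γ / P.ℓ) • hgL.compLp hg0 w + β • w - S z + q)
        = (P.γ / P.ℓ) • (hgL.compLp hg0 v - hgL.compLp hg0 w) + β • (v - w) - S (u - z) := by
      rw [map_sub, smul_sub, smul_sub]; abel
    have h1 : ‖(P.γ / P.ℓ) • (hgL.compLp hg0 v - hgL.compLp hg0 w)‖
        ≤ |P.γ / P.ℓ| * (L * ‖v - w‖) := by
      rw [norm_smul, Real.norm_eq_abs]
      gcongr
      exact hgL.norm_compLp_sub_le hg0 v w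
    have h2 : ‖β • (v - w)‖ = |β| * ‖v - w‖ := by rw [norm_smul, Real.norm_eq_abs]
    have h3 := S.le_opNorm (u - z)
    rw [e]
    refine (norm_sub_le _ _).trans ((add_le_add_left (norm_add_le _ _) _).trans ?_)
    have p1 : 0 ≤ (|P.γ / P.ℓ| * L + |β|) * ‖u - z‖ := by positivity
    have p2 : 0 ≤ ‖S‖ * ‖v - w‖ := by positivity
    nlinarith
  · have hSu : S u = ∑ p, D p • partialL Ω p.1 p.2 u := by
      simp [hS]
    have hpart : ∀ᵐ x ∂volume.restrict Ω, ∀ p : Fin d × Fin d,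
        partialL Ω p.1 p.2 u x = grad (comp u p.1) x p.2 :=
      ae_all_iff.2 fun p => coeFn_partialL p.1 p.2 u
    have hsum := coeFn_sum_smul Finset.univ D (fun p => partialL Ω p.1 p.2 u)
    rw [← hSu] at hsum
    filter_upwards [hpart, hsum, hgL.coeFn_compLp hg0 v, MemLp.coeFn_toLp
      (memLp_const (μ := volume.restrict Ω) (p := 2) (P.γ / P.ℓ * deriv P.Ψ 0 + c)),
      Lp.coeFn_add ((P.γ / P.ℓ) • hgL.compLp hg0 v + β • v - S u) q,
      Lp.coeFn_sub ((P.γ / P.ℓ) • hgL.compLp hg0 v + β • v) (S u),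
      Lp.coeFn_add ((P.γ / P.ℓ) • hgL.compLp hg0 v) (β • v),
      Lp.coeFn_smul (P.γ / P.ℓ) (hgL.compLp hg0 v), Lp.coeFn_smul β v]
      with x h1 h2 h3 h4 h5 h6 h7 h8 h9
    rw [h5, Pi.add_apply, h6, Pi.sub_apply, h7, Pi.add_apply, h8, Pi.smul_apply, h9,
      Pi.smul_apply, h2, h3, hq, h4, hb]
    have e : ∑ p, D p * partialL Ω p.1 p.2 u x = ∑ k, ∑ l, b k l * strain u x k l := by
      have e1 : ∑ p, D p * partialL Ω p.1 p.2 u x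
          = ∑ k, ∑ l, (b k l / 2 * grad (comp u k) x l + b l k / 2 * grad (comp u k) x l) := by
        rw [Fintype.sum_prod_type]
        refine Finset.sum_congr rfl fun k _ => Finset.sum_congr rfl fun l _ => ?_
        rw [h1]; simp only [hD]; ring
      have e2 : ∑ k, ∑ l, b l k / 2 * grad (comp u k) x l
          = ∑ k, ∑ l, b k l / 2 * grad (comp u l) x k := Finset.sum_comm
      rw [e1]
      simp_rw [Finset.sum_add_distrib]
      rw [e2]
      simp_rw [← Finset.sum_add_distrib]
      refine Finset.sum_congr rfl fun k _ => Finset.sum_congr rfl fun l _ => ?_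
      simp only [strain]; ring
    rw [e]
    simp only [hg, smul_eq_mul, Function.comp]
    ring

/-! ### The stability estimate in abstract form -/

theorem MeasureTheory.MemLp.integrable_inner {α H : Type*} [MeasurableSpace α] {μ : Measure α}
    [NormedAddCommGroup H] [InnerProductSpace ℝ H] {f g : α → H} (hf : MemLp f 2 μ)
    (hg : MemLp g 2 μ) : Integrable (fun t => inner ℝ (f t) (g t)) μ :=
  (hf.norm.integrable_mul hg.norm).mono' (hf.1.inner hg.1)
    (ae_of_all _ fun t => norm_inner_le_norm (f t) (g t))

theorem MeasureTheory.MemLp.integrable_clm_apply {α V : Type*} [MeasurableSpace α] {μ : Measure α}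
    [NormedAddCommGroup V] [NormedSpace ℝ V] {f : α → StrongDual ℝ V} {g : α → V}
    (hf : MemLp f 2 μ) (hg : MemLp g 2 μ) : Integrable (fun t => f t (g t)) μ :=
  (hf.norm.integrable_mul hg.norm).mono' (aestronglyMeasurable_apply hf.1 hg.1)
    (ae_of_all _ fun t => (f t).le_opNorm (g t))

/-- Testing on `[0, T]` with a function cut off at time `τ` amounts to testing on `[0, τ]`. -/
theorem setIntegral_apply_indicator_Icc {V : Type*} [Zero V] {T τ : ℝ} (hτ : τ ∈ Icc 0 T)
    (F : ℝ → V → ℝ) (hF : ∀ t, F t 0 = 0) (η : ℝ → V) :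
    ∫ t in Icc 0 T, F t ((Icc 0 τ).indicator η t) = ∫ t in 0..τ, F t (η t) := by
  have h1 : (fun t => F t ((Icc 0 τ).indicator η t)) = (Icc 0 τ).indicator fun t => F t (η t) := by
    funext t
    by_cases ht : t ∈ Icc 0 τ
    · rw [indicator_of_mem ht, indicator_of_mem ht]
    · rw [indicator_of_notMem ht, indicator_of_notMem ht, hF]
  rw [h1, setIntegral_indicator measurableSet_Icc,
    inter_eq_self_of_subset_right (Icc_subset_Icc_right hτ.2), intervalIntegral.integral_of_le hτ.1,
    integral_Icc_eq_integral_Ioc]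

/-- The stability estimate for the linear system `∂ₜφ + m D*D μ = r`, `μ = κ D*D φ + w`, in which
`w` is controlled by `φ` and `u`. The first equation is tested with `φ`, the second with
`m / κ` times `μ`; in the sum the terms `(D μ, D φ)` cancel. -/
theorem energy_estimate {V H H' U : Type*} [NormedAddCommGroup V] [NormedSpace ℝ V]
    [NormedAddCommGroup H] [InnerProductSpace ℝ H] [NormedAddCommGroup H'] [InnerProductSpace ℝ H']
    [NormedAddCommGroup U] (j : V →L[ℝ] H) (D : V →L[ℝ] H') {T m κ K B : ℝ} (hT : 0 < T)
    (hm : 0 < m) (hκ : 0 < κ) (hB : B = 1 + 2 * (m / κ) * K ^ 2)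
    {φ μ : ℝ → V} {φ' : ℝ → StrongDual ℝ V} {w : ℝ → H} {u : ℝ → U} {r : H} {v₀ : V}
    (hφ : MemLp φ ⊤ (timeMeasure T)) (hμ : MemLp μ 2 (timeMeasure T))
    (hφ' : MemLp φ' 2 (timeMeasure T)) (hw : MemLp w 2 (timeMeasure T))
    (hu : MemLp u 2 (timeMeasure T))
    (hwK : ∀ᵐ t ∂timeMeasure T, ‖w t‖ ≤ K * (‖j (φ t)‖ + ‖u t‖))
    (hev : ∀ᵐ t ∂timeMeasure T,
      (innerSL ℝ (j (φ t))).comp j = (innerSL ℝ (j v₀)).comp j + ∫ s in 0..t, φ' s)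
    (hphase : ∀ η : ℝ → V, MemLp η 2 (timeMeasure T) →
      ∫ t in Icc 0 T, (φ' t (η t) + m * inner ℝ (D (μ t)) (D (η t)) - inner ℝ r (j (η t))) = 0)
    (hpot : ∀ η : ℝ → V, MemLp η 2 (timeMeasure T) →
      ∫ t in Icc 0 T, (inner ℝ (j (μ t)) (j (η t)) - κ * inner ℝ (D (φ t)) (D (η t))
        - inner ℝ (w t) (j (η t))) = 0) :
    (∀ᵐ t ∂timeMeasure T, ‖j (φ t)‖ ^ 2 ≤ B * Real.exp (B * T) *
        (‖j v₀‖ ^ 2 + ∫ t in Icc 0 T, (‖u t‖ ^ 2 + ‖r‖ ^ 2))) ∧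
      m / κ * ∫ t in Icc 0 T, ‖j (μ t)‖ ^ 2 ≤ B * Real.exp (B * T) *
        (‖j v₀‖ ^ 2 + ∫ t in Icc 0 T, (‖u t‖ ^ 2 + ‖r‖ ^ 2)) := by
  set β := m / κ with hβ
  have hβ0 : 0 < β := div_pos hm hκ
  have hB1 : 1 ≤ B := by rw [hB]; linarith [show 0 ≤ 2 * β * K ^ 2 by positivity]
  have hφ2 : MemLp φ 2 (timeMeasure T) := hφ.mono_exponent le_top
  have hjφ : MemLp (fun t => j (φ t)) 2 (timeMeasure T) := j.comp_memLp' hφ2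
  have hjμ : MemLp (fun t => j (μ t)) 2 (timeMeasure T) := j.comp_memLp' hμ
  have hDφ : MemLp (fun t => D (φ t)) 2 (timeMeasure T) := D.comp_memLp' hφ2
  have hDμ : MemLp (fun t => D (μ t)) 2 (timeMeasure T) := D.comp_memLp' hμ
  have hr : MemLp (fun _ : ℝ => r) 2 (timeMeasure T) := memLp_const r
  have i1 := MemLp.integrable_clm_apply hφ' hφ2
  have i2 := MemLp.integrable_inner hDμ hDφ
  have i3 := MemLp.integrable_inner hr hjφ
  have i4 : Integrable (fun t => ‖j (μ t)‖ ^ 2) (timeMeasure T) := hjμ.norm.integrable_sq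
  have i5 := MemLp.integrable_inner hw hjμ
  have i6 : Integrable (fun t => ‖j (φ t)‖ ^ 2) (timeMeasure T) := hjφ.norm.integrable_sq
  have i7 : Integrable (fun t => ‖u t‖ ^ 2 + ‖r‖ ^ 2) (timeMeasure T) :=
    hu.norm.integrable_sq.add (integrable_const _)
  have toI : ∀ {f : ℝ → ℝ}, Integrable f (timeMeasure T) → ∀ τ ∈ Icc 0 T,
      IntervalIntegrable f volume 0 τ := by
    intro f hf τ hτ
    rw [intervalIntegrable_iff_integrableOn_Icc_of_le hτ.1]
    exact IntegrableOn.mono_set hf (Icc_subset_Icc_right hτ.2)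
  set F := ∫ t in Icc 0 T, (‖u t‖ ^ 2 + ‖r‖ ^ 2) with hF
  have hF0 : 0 ≤ F := integral_nonneg fun t => by positivity
  have hy : ∀ᵐ τ ∂timeMeasure T, ‖j (φ τ)‖ ^ 2 + ∫ t in 0..τ, β * ‖j (μ t)‖ ^ 2
      ≤ B * (‖j v₀‖ ^ 2 + F) + B * ∫ t in 0..τ, ‖j (φ t)‖ ^ 2 := by
    filter_upwards [half_norm_sq_le_add_integral j hφ (hφ'.integrable (by norm_num)) v₀ hev,
      ae_restrict_mem measurableSet_Icc] with τ hτ hτT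
    have e1 := hphase _ (hφ2.indicator (s := Icc 0 τ) measurableSet_Icc)
    have e2 := hpot _ (hμ.indicator (s := Icc 0 τ) measurableSet_Icc)
    rw [setIntegral_apply_indicator_Icc hτT
      (fun t v => φ' t v + m * inner ℝ (D (μ t)) (D v) - inner ℝ r (j v)) (by simp) φ,
      intervalIntegral.integral_sub ((toI i1 τ hτT).add ((toI i2 τ hτT).const_mul m))
        (toI i3 τ hτT),
      intervalIntegral.integral_add (toI i1 τ hτT) ((toI i2 τ hτT).const_mul m),
      intervalIntegral.integral_const_mul] at e1
    rw [setIntegral_apply_indicator_Icc hτT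
      (fun t v => inner ℝ (j (μ t)) (j v) - κ * inner ℝ (D (φ t)) (D v) - inner ℝ (w t) (j v))
      (by simp) μ] at e2
    simp_rw [real_inner_self_eq_norm_sq, real_inner_comm (D (μ _)) (D (φ _))] at e2
    rw [intervalIntegral.integral_sub ((toI i4 τ hτT).sub ((toI i2 τ hτT).const_mul κ))
        (toI i5 τ hτT),
      intervalIntegral.integral_sub (toI i4 τ hτT) ((toI i2 τ hτT).const_mul κ),
      intervalIntegral.integral_const_mul] at e2
    -- Young's inequality for `(r, φ)` and `(w, μ)`; half of the dissipation absorbs `‖μ‖²`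
    have hY : ∫ t in 0..τ, (2 * inner ℝ r (j (φ t)) + 2 * β * inner ℝ (w t) (j (μ t)))
        ≤ ∫ t in 0..τ, (B * ‖j (φ t)‖ ^ 2 + β * ‖j (μ t)‖ ^ 2 + B * (‖u t‖ ^ 2 + ‖r‖ ^ 2)) := by
      refine intervalIntegral.integral_mono_ae_restrict hτT.1
        (((toI i3 τ hτT).const_mul _).add ((toI i5 τ hτT).const_mul _))
        ((((toI i6 τ hτT).const_mul _).add ((toI i4 τ hτT).const_mul _)).add
          ((toI i7 τ hτT).const_mul _)) ?_
      filter_upwards [ae_restrict_of_ae_restrict_of_subset (Icc_subset_Icc_right hτT.2) hwK]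
        with t ht
      have a1 := real_inner_le_norm r (j (φ t))
      have a2 := real_inner_le_norm (w t) (j (μ t))
      have a3 : ‖w t‖ ^ 2 ≤ 2 * K ^ 2 * (‖j (φ t)‖ ^ 2 + ‖u t‖ ^ 2) := by
        have : ‖w t‖ ^ 2 ≤ (K * (‖j (φ t)‖ + ‖u t‖)) ^ 2 :=
          pow_le_pow_left₀ (norm_nonneg _) ht 2
        nlinarith [mul_nonneg (sq_nonneg K) (sq_nonneg (‖j (φ t)‖ - ‖u t‖))]
      have a4 : 2 * inner ℝ r (j (φ t)) ≤ ‖r‖ ^ 2 + ‖j (φ t)‖ ^ 2 := by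
        nlinarith [sq_nonneg (‖r‖ - ‖j (φ t)‖)]
      have a5 : 2 * inner ℝ (w t) (j (μ t)) ≤ ‖j (μ t)‖ ^ 2
          + 2 * K ^ 2 * (‖j (φ t)‖ ^ 2 + ‖u t‖ ^ 2) := by
        nlinarith [sq_nonneg (‖w t‖ - ‖j (μ t)‖)]
      have a6 := mul_le_mul_of_nonneg_left a5 hβ0.le
      have a7 : 0 ≤ 2 * β * K ^ 2 * ‖r‖ ^ 2 := by positivity
      have a8 : 0 ≤ ‖u t‖ ^ 2 := by positivity
      simp only [hB]
      nlinarith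
    rw [intervalIntegral.integral_add ((toI i3 τ hτT).const_mul _) ((toI i5 τ hτT).const_mul _),
      intervalIntegral.integral_add (((toI i6 τ hτT).const_mul _).add ((toI i4 τ hτT).const_mul _))
        ((toI i7 τ hτT).const_mul _),
      intervalIntegral.integral_add ((toI i6 τ hτT).const_mul _) ((toI i4 τ hτT).const_mul _)] at hY
    simp only [intervalIntegral.integral_const_mul] at hY ⊢
    have hFτ : ∫ t in 0..τ, (‖u t‖ ^ 2 + ‖r‖ ^ 2) ≤ F := by
      rw [intervalIntegral.integral_of_le hτT.1, hF]
      exact setIntegral_mono_set i7 (ae_of_all _ fun t => by positivity)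
        (Ioc_subset_Icc_self.trans (Icc_subset_Icc_right hτT.2)).eventuallyLE
    -- adding `β` times the second equation to the first eliminates `∫ (D μ, D φ)`
    have hκβ : κ * β = m := by rw [hβ]; field_simp
    have e3 := congrArg (β * ·) e2
    simp only [mul_zero, mul_sub, ← mul_assoc, mul_comm β κ, hκβ] at e3
    have b1 := mul_le_mul_of_nonneg_left hFτ (zero_le_one.trans hB1)
    have b2 := le_mul_of_one_le_left (sq_nonneg ‖j v₀‖) hB1
    linarith
  obtain ⟨h1, h2⟩ := ae_gronwall hT (by positivity) (zero_le_one.trans hB1) i6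
    (i4.const_mul β) (fun _ => by positivity) (fun _ => by positivity) hy
  rw [integral_const_mul] at h2
  have e : B * (‖j v₀‖ ^ 2 + F) * Real.exp (B * T) = B * Real.exp (B * T) * (‖j v₀‖ ^ 2 + F) := by
    ring
  rw [e] at h1 h2
  exact ⟨h1, h2⟩

/-! ### The Cahn-Hilliard equations -/

theorem integrable_phase_terms {d : ℕ} {Ω : Set (E d)} {T : ℝ} {φ' : ℝ → H1Dual Ω}
    {μ η : ℝ → H1 Ω} (hφ' : MemLp φ' 2 (timeMeasure T)) (hμ : MemLp μ 2 (timeMeasure T))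
    (hη : MemLp η 2 (timeMeasure T)) (m : ℝ) :
    Integrable (fun t => φ' t (η t) + m * inner ℝ (gradL Ω (μ t)) (gradL Ω (η t)))
      (timeMeasure T) :=
  (MemLp.integrable_clm_apply hφ' hη).add
    ((MemLp.integrable_inner ((gradL Ω).comp_memLp' hμ)
      ((gradL Ω).comp_memLp' hη)).const_mul m)

theorem integrable_inner_fnL {d : ℕ} {Ω : Set (E d)} {T : ℝ} {w : ℝ → L2 Ω} {η : ℝ → H1 Ω}
    (hw : MemLp w 2 (timeMeasure T)) (hη : MemLp η 2 (timeMeasure T)) :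
    Integrable (fun t => inner ℝ (w t) (fnL Ω (η t))) (timeMeasure T) :=
  MemLp.integrable_inner hw ((fnL Ω).comp_memLp' hη)

theorem integrable_potential_terms {d : ℕ} {Ω : Set (E d)} {T : ℝ} {φ μ η : ℝ → H1 Ω}
    {w : ℝ → L2 Ω} (hφ : MemLp φ 2 (timeMeasure T)) (hμ : MemLp μ 2 (timeMeasure T))
    (hw : MemLp w 2 (timeMeasure T)) (hη : MemLp η 2 (timeMeasure T)) (κ : ℝ) :
    Integrable (fun t => inner ℝ (fnL Ω (μ t)) (fnL Ω (η t))
      - κ * inner ℝ (gradL Ω (φ t)) (gradL Ω (η t)) - inner ℝ (w t) (fnL Ω (η t)))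
      (timeMeasure T) :=
  ((integrable_inner_fnL ((fnL Ω).comp_memLp' hμ) hη).sub
    ((MemLp.integrable_inner ((gradL Ω).comp_memLp' hφ)
      ((gradL Ω).comp_memLp' hη)).const_mul κ)).sub (integrable_inner_fnL hw hη)

/-- The phase equation for constant mobility, with the time derivative integrated. -/
theorem CHB.IsWeakSolution.phase_data {d : ℕ} {Ω : Set (E d)} {T : ℝ} (hT : 0 < T) {P : Model d}
    {D : Data Ω} {X : State Ω} (hX : IsWeakSolution Ω T P D X) {m : ℝ} (hm : ∀ s, P.m s = m) :
    ∃ φ' : ℝ → H1Dual Ω, MemLp φ' 2 (timeMeasure T) ∧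
      (∀ᵐ t ∂timeMeasure T, (innerSL ℝ (fnL Ω (X.φ t))).comp (fnL Ω)
        = (innerSL ℝ (fnL Ω D.φ₀)).comp (fnL Ω) + ∫ s in 0..t, φ' s) ∧
      ∀ η : ℝ → H1 Ω, MemLp η 2 (timeMeasure T) →
        ∫ t in Icc 0 T, (φ' t (η t) + m * inner ℝ (gradL Ω (X.μ t)) (gradL Ω (η t))
          - inner ℝ D.R (fnL Ω (η t))) = 0 := by
  obtain ⟨φ', hφ', hder, heq⟩ := hX.phase
  refine ⟨φ', hφ', ?_, fun η hη => ?_⟩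
  · have hint : IntegrableOn (fun t => toH1Dual (fn (X.φ t))) (Icc 0 T) := by
      have : MemLp (fun t => ((ContinuousLinearMap.precomp ℝ (fnL Ω)).comp
          ((innerSL ℝ).comp (fnL Ω))) (X.φ t)) ⊤ (timeMeasure T) :=
        ContinuousLinearMap.comp_memLp' _ hX.φ_mem
      exact this.integrable le_top
    exact ae_eq_add_integral_of_isWeakTimeDeriv hT hint (hφ'.integrable (by norm_num)) hder
      hX.φ_init
  · have h := heq η hη
    simp_rw [hm, integral_const_mul, ← L2.inner_def] at h
    rw [integral_sub (integrable_phase_terms hφ' hX.μ_mem hη m)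
      (integrable_inner_fnL (memLp_const D.R) hη)]
    exact sub_eq_zero.2 h

theorem memLp_of_lipschitz_two {α X Y Z : Type*} [MeasurableSpace α] {μ : Measure α}
    [IsFiniteMeasure μ] [NormedAddCommGroup X] [NormedAddCommGroup Y] [NormedAddCommGroup Z]
    {W : X → Y → Z} {K : ℝ}
    (hW : ∀ v w u z, ‖W v u - W w z‖ ≤ K * (‖v - w‖ + ‖u - z‖)) {f : α → X} {g : α → Y}
    (hf : MemLp f 2 μ) (hg : MemLp g 2 μ) : MemLp (fun t => W (f t) (g t)) 2 μ := by
  have hc : Continuous fun p : X × Y => W p.1 p.2 := by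
    refine continuous_iff_continuousAt.2 fun p => ?_
    rw [ContinuousAt, tendsto_iff_norm_sub_tendsto_zero]
    refine squeeze_zero (fun _ => norm_nonneg _) (fun q => hW q.1 p.1 q.2 p.2) ?_
    have : Continuous fun q : X × Y => K * (‖q.1 - p.1‖ + ‖q.2 - p.2‖) := by fun_prop
    simpa using this.tendsto p
  have hb : MemLp (fun t => K * (‖f t‖ + ‖g t‖) + ‖W 0 0‖) 2 μ :=
    ((hf.norm.add hg.norm).const_mul K).add (memLp_const _)
  refine hb.of_le (hc.comp_aestronglyMeasurable (hf.1.prodMk hg.1)) (ae_of_all _ fun t => ?_)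
  have h1 := hW (f t) 0 (g t) 0
  rw [sub_zero, sub_zero] at h1
  calc ‖W (f t) (g t)‖ ≤ ‖W (f t) (g t) - W 0 0‖ + ‖W 0 0‖ := norm_le_norm_sub_add _ _
    _ ≤ K * (‖f t‖ + ‖g t‖) + ‖W 0 0‖ := by gcongr
    _ ≤ _ := le_abs_self _

theorem CHB.Model.HomogeneousLaws.memLp_deriv_Ψ {d : ℕ} {Ω : Set (E d)}
    (hΩ : Bornology.IsBounded Ω) {P : Model d} (hP : P.HomogeneousLaws) (v : L2 Ω) :
    MemLp (fun x => deriv P.Ψ (v x)) 2 (volume.restrict Ω) := by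
  have := isFiniteMeasure_restrict_of_isBounded hΩ
  obtain ⟨L, hL⟩ := hP.lipschitz_Ψ'
  have hb : MemLp (fun x => L * ‖v x‖ + ‖deriv P.Ψ 0‖) 2 (volume.restrict Ω) :=
    ((Lp.memLp v).norm.const_mul _).add (memLp_const _)
  refine hb.of_le (hL.continuous.comp_aestronglyMeasurable (Lp.memLp v).1)
    (ae_of_all _ fun x => ?_)
  have h := hL.norm_sub_le (v x) 0
  rw [sub_zero] at h
  exact (norm_le_norm_sub_add _ (deriv P.Ψ 0)).trans
    ((add_le_add_left h _).trans (le_abs_self _))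

/-- The equation for the chemical potential, with all terms free of derivatives of the phase field
collected in `W`. The fluid energy does not contribute, as `M` and `α` are constant. -/
theorem CHB.IsWeakSolution.potential_data {d : ℕ} {Ω : Set (E d)} {T : ℝ} {P : Model d}
    {D : Data Ω} {X : State Ω} (hX : IsWeakSolution Ω T P D X) (hΩ : Bornology.IsBounded Ω)
    (hP : P.HomogeneousLaws) {W : L2 Ω → H10v Ω → L2 Ω}
    (hW : ∀ v u, W v u =ᵐ[volume.restrict Ω]
      fun x => P.γ / P.ℓ * deriv P.Ψ (v x) + P.dPhiEe (v x) (strain u x))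
    {η : ℝ → H1 Ω} (hη : MemLp η 2 (timeMeasure T)) :
    ∫ t in Icc 0 T, (inner ℝ (fnL Ω (X.μ t)) (fnL Ω (η t))
      - P.γ * P.ℓ * inner ℝ (gradL Ω (X.φ t)) (gradL Ω (η t))
      - inner ℝ (W (fnL Ω (X.φ t)) (X.u t)) (fnL Ω (η t))) = 0 := by
  refine Eq.trans ?_ (hX.potential η hη)
  refine integral_congr_ae (ae_of_all _ fun t => ?_)
  have h1 : inner ℝ (W (fnL Ω (X.φ t)) (X.u t)) (fnL Ω (η t))
      = P.γ / P.ℓ * (∫ x in Ω, deriv P.Ψ (fn (X.φ t) x) * fn (η t) x)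
        + ∫ x in Ω, P.dPhiEe (fn (X.φ t) x) (strain (X.u t) x) * fn (η t) x := by
    have m1 : MemLp (fun x => P.γ / P.ℓ * deriv P.Ψ (fn (X.φ t) x)) 2 (volume.restrict Ω) :=
      (hP.memLp_deriv_Ψ hΩ _).const_mul _
    -- each density is square integrable by itself, so the integral of their sum splits
    have m2 : MemLp (fun x => P.dPhiEe (fn (X.φ t) x) (strain (X.u t) x)) 2
        (volume.restrict Ω) := by
      refine MemLp.ae_eq ?_ ((Lp.memLp (W (fn (X.φ t)) (X.u t))).sub m1)
      filter_upwards [hW (fn (X.φ t)) (X.u t)] with x hx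
      simp [hx]
    have m3 : MemLp (fn (η t)) 2 (volume.restrict Ω) := Lp.memLp _
    rw [L2.inner_def, ← integral_const_mul]
    simp_rw [← mul_assoc]
    refine Eq.trans ?_ (integral_add (m1.integrable_mul m3) (m2.integrable_mul m3))
    refine integral_congr_ae ?_
    filter_upwards [hW (fn (X.φ t)) (X.u t)] with x hx
    simp only [fnL_apply, hx, RCLike.inner_apply, conj_trivial]
    ring
  simp only [hP.dPhiEf_eq_zero, zero_mul, integral_zero, h1]
  simp only [fnL_apply, gradL_apply]
  ring

theorem enorm_sq_eq_ofReal {V : Type*} [NormedAddCommGroup V] (x : V) :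
    ‖x‖ₑ ^ 2 = ENNReal.ofReal (‖x‖ ^ 2) := by
  rw [← ofReal_norm, ENNReal.ofReal_pow (norm_nonneg x)]

theorem essSup_add_lintegral_le {T : ℝ} {V : Type*} [NormedAddCommGroup V] {f g : ℝ → V}
    {a b : ℝ} (hg : MemLp g 2 (timeMeasure T)) (hfa : ∀ᵐ t ∂timeMeasure T, ‖f t‖ ^ 2 ≤ a)
    (ha : 0 ≤ a) (hgb : ∫ t in Icc 0 T, ‖g t‖ ^ 2 ≤ b) :
    essSup (fun t => ‖f t‖ₑ ^ 2) (timeMeasure T) + ∫⁻ t in Icc 0 T, ‖g t‖ₑ ^ 2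
      ≤ ENNReal.ofReal (a + b) := by
  have hb : 0 ≤ b := (integral_nonneg fun t => by positivity).trans hgb
  rw [ENNReal.ofReal_add ha hb]
  refine add_le_add (essSup_le_of_ae_le _ ?_) ?_
  · filter_upwards [hfa] with t ht
    rw [enorm_sq_eq_ofReal]
    exact ENNReal.ofReal_le_ofReal ht
  · simp_rw [enorm_sq_eq_ofReal]
    rw [← ofReal_integral_eq_lintegral_ofReal hg.norm.integrable_sq
      (ae_of_all _ fun t => by positivity)]
    exact ENNReal.ofReal_le_ofReal hgb

theorem mainTheorem4 {d : ℕ} (hd : d = 2 ∨ d = 3)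
    (Ω : Set (E d)) (hΩ_open : IsOpen Ω) (hΩ_conn : IsConnected Ω)
    (hΩ_bdd : Bornology.IsBounded Ω) (hΩ_lip : HasLipschitzBoundary Ω)
    (T : ℝ) (hT : 0 < T)
    (P : Model d) (hγ : 0 < P.γ) (hℓ : 0 < P.ℓ) (hP : P.HomogeneousLaws) :
    ∃ C : ℝ≥0, 0 < C ∧
      ∀ D₁ D₂ : Data Ω,
        Integrable (fun x => P.Ψ (fn D₁.φ₀ x)) (volume.restrict Ω) →
        Integrable (fun x => P.Ψ (fn D₂.φ₀ x)) (volume.restrict Ω) →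
        ∀ X₁ X₂ : State Ω,
          IsWeakSolution Ω T P D₁ X₁ → HasRegularFlux Ω T X₁.q →
          IsWeakSolution Ω T P D₂ X₂ → HasRegularFlux Ω T X₂.q →
          essSup (fun t => ‖fn (X₁.φ t) - fn (X₂.φ t)‖ₑ ^ 2) (timeMeasure T)
              + ∫⁻ t in Icc 0 T, ‖fn (X₁.μ t) - fn (X₂.μ t)‖ₑ ^ 2
            ≤ C * (‖fn D₁.φ₀ - fn D₂.φ₀‖ₑ ^ 2
                + ∫⁻ t in Icc 0 T, (‖X₁.u t - X₂.u t‖ₑ ^ 2 + ‖D₁.R - D₂.R‖ₑ ^ 2)) := by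
  obtain ⟨W, K, hWlip, hW⟩ := hP.exists_lipschitz_potential hΩ_bdd
  obtain ⟨m, hm, hPm⟩ := hP.const_m
  set κ := P.γ * P.ℓ
  have hκ0 : 0 < κ := mul_pos hγ hℓ
  set B := 1 + 2 * (m / κ) * K ^ 2 with hB
  set c := B * Real.exp (B * T)
  have hB0 : 0 < B := by positivity
  -- `c` bounds the phase field, `κ / m * c` the chemical potential
  refine ⟨(c + κ / m * c).toNNReal, Real.toNNReal_pos.2 (by positivity), ?_⟩
  intro D₁ D₂ _ _ X₁ X₂ h₁ _ h₂ _
  obtain ⟨φ'₁, hφ'₁, hev₁, hph₁⟩ := h₁.phase_data hT hPm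
  obtain ⟨φ'₂, hφ'₂, hev₂, hph₂⟩ := h₂.phase_data hT hPm
  have hφ₁ : MemLp X₁.φ 2 (timeMeasure T) := h₁.φ_mem.mono_exponent le_top
  have hφ₂ : MemLp X₂.φ 2 (timeMeasure T) := h₂.φ_mem.mono_exponent le_top
  have hu₁ : MemLp X₁.u 2 (timeMeasure T) := h₁.u_mem.mono_exponent le_top
  have hu₂ : MemLp X₂.u 2 (timeMeasure T) := h₂.u_mem.mono_exponent le_top
  have hw₁ := memLp_of_lipschitz_two hWlip ((fnL Ω).comp_memLp' hφ₁) hu₁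
  have hw₂ := memLp_of_lipschitz_two hWlip ((fnL Ω).comp_memLp' hφ₂) hu₂
  have hiI : ∀ {φ' : ℝ → H1Dual Ω}, MemLp φ' 2 (timeMeasure T) → ∀ t ∈ Icc 0 T,
      IntervalIntegrable φ' volume 0 t := by
    intro φ' hφ' t ht
    rw [intervalIntegrable_iff_integrableOn_Icc_of_le ht.1]
    exact IntegrableOn.mono_set (hφ'.integrable (by norm_num)) (Icc_subset_Icc_right ht.2)
  obtain ⟨hE₁, hE₂⟩ := energy_estimate (fnL Ω) (gradL Ω) (m := m) (κ := κ) (K := K) hT hm hκ0 hB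
    (φ := fun t => X₁.φ t - X₂.φ t) (μ := fun t => X₁.μ t - X₂.μ t)
    (φ' := fun t => φ'₁ t - φ'₂ t)
    (w := fun t => W (fnL Ω (X₁.φ t)) (X₁.u t) - W (fnL Ω (X₂.φ t)) (X₂.u t))
    (u := fun t => X₁.u t - X₂.u t) (r := D₁.R - D₂.R) (v₀ := D₁.φ₀ - D₂.φ₀)
    (h₁.φ_mem.sub h₂.φ_mem) (h₁.μ_mem.sub h₂.μ_mem) (hφ'₁.sub hφ'₂) (hw₁.sub hw₂)
    (hu₁.sub hu₂)
    (ae_of_all _ fun t => by rw [map_sub]; exact hWlip _ _ _ _)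
    (by
      filter_upwards [hev₁, hev₂, ae_restrict_mem measurableSet_Icc] with t e₁ e₂ ht
      rw [intervalIntegral.integral_sub (hiI hφ'₁ t ht) (hiI hφ'₂ t ht)]
      simp only [map_sub, ContinuousLinearMap.sub_comp, e₁, e₂]
      abel)
    (by
      intro η hη
      have h := integral_sub
        ((integrable_phase_terms hφ'₁ h₁.μ_mem hη m).sub
          (integrable_inner_fnL (memLp_const D₁.R) hη))
        ((integrable_phase_terms hφ'₂ h₂.μ_mem hη m).sub
          (integrable_inner_fnL (memLp_const D₂.R) hη))
      refine Eq.trans ?_ (h.trans (sub_eq_zero.2 ((hph₁ η hη).trans (hph₂ η hη).symm)))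
      refine integral_congr_ae (ae_of_all _ fun t => ?_)
      simp only [map_sub, inner_sub_left, sub_apply, Pi.sub_apply]
      ring)
    (by
      intro η hη
      have h := integral_sub (integrable_potential_terms hφ₁ h₁.μ_mem hw₁ hη κ)
        (integrable_potential_terms hφ₂ h₂.μ_mem hw₂ hη κ)
      refine Eq.trans ?_ (h.trans (sub_eq_zero.2
        ((h₁.potential_data hΩ_bdd hP hW hη).trans (h₂.potential_data hΩ_bdd hP hW hη).symm)))
      refine integral_congr_ae (ae_of_all _ fun t => ?_)
      simp only [map_sub, inner_sub_left, Function.comp]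
      ring)
  set F := ‖fnL Ω (D₁.φ₀ - D₂.φ₀)‖ ^ 2
    + ∫ t in Icc 0 T, (‖X₁.u t - X₂.u t‖ ^ 2 + ‖D₁.R - D₂.R‖ ^ 2) with hF
  have hF0 : 0 ≤ F := add_nonneg (by positivity) (integral_nonneg fun t => by positivity)
  have hE₂' : ∫ t in Icc 0 T, ‖fnL Ω (X₁.μ t - X₂.μ t)‖ ^ 2 ≤ κ / m * (c * F) := by
    have := mul_le_mul_of_nonneg_left hE₂ (show 0 ≤ κ / m by positivity)
    rwa [← mul_assoc, div_mul_div_cancel₀ hm.ne', div_self hκ0.ne', one_mul] at this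
  have hfin := essSup_add_lintegral_le (f := fun t => fnL Ω (X₁.φ t - X₂.φ t))
    (g := fun t => fnL Ω (X₁.μ t - X₂.μ t))
    ((fnL Ω).comp_memLp' (h₁.μ_mem.sub h₂.μ_mem)) hE₁ (by positivity) hE₂'
  simp only [map_sub, fnL_apply] at hfin
  refine hfin.trans (le_of_eq ?_)
  have hI : Integrable (fun t => ‖X₁.u t - X₂.u t‖ ^ 2 + ‖D₁.R - D₂.R‖ ^ 2) (timeMeasure T) :=
    (hu₁.sub hu₂).norm.integrable_sq.add (integrable_const _)
  simp_rw [enorm_sq_eq_ofReal, ← ENNReal.ofReal_add (sq_nonneg _) (sq_nonneg _)]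
  rw [← ofReal_integral_eq_lintegral_ofReal hI (ae_of_all _ fun t => by positivity),
    ← ENNReal.ofReal_add (by positivity) (integral_nonneg fun t => by positivity)]
  -- `ENNReal.ofReal` is by definition the coercion of `Real.toNNReal`
  rw [← ENNReal.ofReal.eq_1, ← ENNReal.ofReal_mul (by positivity)]
  congr 1
  simp only [hF, map_sub, fnL_apply]
  ring
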